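/- \textbf{Setting.} Fix a signature without function symbols of positive arity, with a non-empty set $C$ of constants (an effectively encoded set, finite or infinite) and effectively encoded CHR predicate symbols; a predicate symbol is a name together with its arity. Terms are variables and constants. The only built-in constraints are equations $t=u$ between terms, interpreted as equality on the Herbrand universe $C$; the conjunction of the empty list of equations is $true$, and $\mathcal{CT}\models\varphi$ means that $\varphi$ holds in $C$ under all valuations. A \emph{rule} has the form $H^k\backslash H^h\Longleftrightarrow g\mid B$, where $H^k,H^h$ are finite multisets of CHR constraints, not both empty, $g$ is a conjunction of equations and $B$ is a finite multiset of CHR constraints and equations. It is \emph{range-restricted} if $Var(B)\cup Var(g)\subseteq Var(H^k)\cup Var(H^h)$. A \emph{program} is a finite list of rules; it is range-restricted if all its rules are. A \emph{goal} is a finite multiset of CHR constraints and equations. \textbf{Abstract semantics $\omega_o$.} A configuration $\langle G,S,B\rangle_n$ consists of a multiset $G$ of constraints, a finite set $S$ of identified CHR constraints $c\#i$, a conjunction $B$ of equations (the built-in store), and the next free identifier $n\in\mathbb N$. The transitions for a program $P$ are: \begin{itemize} \item \textbf{Solve:} $\langle\{e\}\uplus G,S,B\rangle_n\to\langle G,S,e\wedge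 B\rangle_n$ for an equation $e$; \item \textbf{Introduce:} $\langle\{c\}\uplus G,S,B\rangle_n\to\langle G,\{c\#n\}\cup S,B\rangle_{n+1}$ for a CHR constraint $c$; \item \textbf{Apply:} $\langle G,H_1\cup H_2\cup S,B\rangle_n\to\langle D\theta\uplus G,\,H_1\cup S,\,E\wedge B\rangle_n$, where $H_1,H_2,S$ are pairwise disjoint, $P$ contains a rule $H_1'\backslash H_2'\Longleftrightarrow g\mid D$ and $\theta$ is a substitution that sends the variables of the rule head to arguments of constraints in $H_1\cup H_2$, such that $H_1,H_2$ correspond one to one to $H_1'\theta,H_2'\theta$ with equal predicate symbols. $E$ is the conjunction of the equations between the arguments of the constraints in $H_1,H_2$ and those of the corresponding instantiated heads. The applicability condition is one of the following two. \begin{itemize} \item[(a)] \emph{Syntactic matching:} the constraints in $H_1,H_2$, without identifiers, are identical to the corresponding constraints of $H_1'\theta,H_2'\theta$, and $\mathcal{CT}\models B\to\exists_{-Fv(B)}(E\wedge g\theta)$, where $\exists_{-Fv(B)}$ quantifies existentially all variables that do not occur in $B$. \item[(b)] \emph{Matching modulo the built-in store:} $\mathcal{CT}\models B\to(E\wedge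 g\theta)$. \end{itemize} \end{itemize} (There is no propagation history, and rules may have several heads. These are the transitions for range-restricted programs, where no variable of a rule is left uninstantiated by $\theta$.) A configuration is \emph{final} if its built-in store is unsatisfiable (it is failed), or if its goal component is empty and no transition is possible. An \emph{infinite computation} for a goal $G$ in $P$ is an infinite sequence of transitions that starts in $\langle G,\emptyset,true\rangle_1$ and contains no final configuration. \textbf{Theorem.} Under either form (a), (b) of matching, the existence of an infinite computation is decidable for range-restricted CHR($C$): there is an algorithm (a total computable function) which, given a range-restricted program $P$ and a goal $G$, decides whether $G$ has an infinite computation in $P$. -/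

import Mathlib

namespace CHR

/-! ## Syntax of CHR(C)

`C` is the type of constants of the signature, i.e. the Herbrand universe (there are no function
symbols of positive arity), and `Q` is the type of names of CHR predicates.  Variables are natural
numbers.  A predicate symbol is a name together with its number of arguments. -/

/-- A term is a variable or a constant. -/
inductive Term (C : Type*) where
  | var (x : ℕ)
  | const (a : C)
  deriving DecidableEq

/-- A built-in constraint: an equation `lhs = rhs` between terms. -/
structure Eqn (C : Type*) where
  lhs : Term C
  rhs : Term C
  deriving DecidableEq

/-- A CHR (user-defined) constraint `name(args)`. -/
structure Atom (C Q : Type*) where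
  name : Q
  args : List (Term C)
  deriving DecidableEq

/-- A constraint is a CHR constraint or a built-in constraint. -/
inductive Constraint (C Q : Type*) where
  | user (a : Atom C Q)
  | builtin (e : Eqn C)
  deriving DecidableEq

/-- A simpagation rule `kept \ removed <=> guard | body`.  The guard is the conjunction of the
listed equations; the empty guard is `true`. -/
structure Rule (C Q : Type*) where
  kept : List (Atom C Q)
  removed : List (Atom C Q)
  guard : List (Eqn C)
  body : List (Constraint C Q)
  deriving DecidableEq

/-- A program is a sequence of rules. -/
abbrev Program (C Q : Type*) := List (Rule C Q)

/-- A goal is a finite multiset of constraints, presented by a list. -/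
abbrev Goal (C Q : Type*) := List (Constraint C Q)

/-! ### Encodings of the syntax -/

section Encodings

variable {C Q : Type*}

def termEquiv : Term C ≃ ℕ ⊕ C where
  toFun
    | .var x => .inl x
    | .const a => .inr a
  invFun
    | .inl x => .var x
    | .inr a => .const a
  left_inv t := by cases t <;> rfl
  right_inv t := by cases t <;> rfl

def eqnEquiv : Eqn C ≃ Term C × Term C where
  toFun e := (e.lhs, e.rhs)
  invFun p := ⟨p.1, p.2⟩
  left_inv _ := rfl
  right_inv _ := rfl

def atomEquiv : Atom C Q ≃ Q × List (Term C) where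
  toFun a := (a.name, a.args)
  invFun p := ⟨p.1, p.2⟩
  left_inv _ := rfl
  right_inv _ := rfl

def constraintEquiv : Constraint C Q ≃ Atom C Q ⊕ Eqn C where
  toFun
    | .user a => .inl a
    | .builtin e => .inr e
  invFun
    | .inl a => .user a
    | .inr e => .builtin e
  left_inv c := by cases c <;> rfl
  right_inv c := by cases c <;> rfl

def ruleEquiv : Rule C Q ≃
    (List (Atom C Q) × List (Atom C Q)) × (List (Eqn C) × List (Constraint C Q)) where
  toFun r := ((r.kept, r.removed), (r.guard, r.body))
  invFun p := ⟨p.1.1, p.1.2, p.2.1, p.2.2⟩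
  left_inv _ := rfl
  right_inv _ := rfl

variable [Primcodable C] [Primcodable Q]

instance : Primcodable (Term C) := Primcodable.ofEquiv _ termEquiv
instance : Primcodable (Eqn C) := Primcodable.ofEquiv _ eqnEquiv
instance : Primcodable (Atom C Q) := Primcodable.ofEquiv _ atomEquiv
instance : Primcodable (Constraint C Q) := Primcodable.ofEquiv _ constraintEquiv
instance : Primcodable (Rule C Q) := Primcodable.ofEquiv _ ruleEquiv

end Encodings

variable {C Q : Type*}

/-! ### Variables -/

def Term.vars : Term C → Set ℕ
  | .var x => {x}
  | .const _ => ∅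

def Eqn.vars (e : Eqn C) : Set ℕ := e.lhs.vars ∪ e.rhs.vars

def Atom.vars (a : Atom C Q) : Set ℕ := {x | ∃ t ∈ a.args, x ∈ t.vars}

def Constraint.vars : Constraint C Q → Set ℕ
  | .user a => a.vars
  | .builtin e => e.vars

/-- The variables of a conjunction of equations. -/
def eqnVars (B : List (Eqn C)) : Set ℕ := {x | ∃ e ∈ B, x ∈ e.vars}

namespace Rule

def headVars (r : Rule C Q) : Set ℕ := {x | ∃ a ∈ r.kept ++ r.removed, x ∈ a.vars}

def guardVars (r : Rule C Q) : Set ℕ := eqnVars r.guard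

def bodyVars (r : Rule C Q) : Set ℕ := {x | ∃ c ∈ r.body, x ∈ c.vars}

/-- At least one of the two heads of a rule is non-empty. -/
def WellFormed (r : Rule C Q) : Prop := r.kept ≠ [] ∨ r.removed ≠ []

/-- Every variable of the body or of the guard occurs in the head. -/
def RangeRestricted (r : Rule C Q) : Prop := r.bodyVars ∪ r.guardVars ⊆ r.headVars

end Rule

def Program.WellFormed (P : Program C Q) : Prop := ∀ r ∈ P, r.WellFormed

def Program.RangeRestricted (P : Program C Q) : Prop := ∀ r ∈ P, r.RangeRestricted

/-! ### Substitutions -/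

def Term.subst (θ : ℕ → Term C) : Term C → Term C
  | .var x => θ x
  | .const a => .const a

def Eqn.subst (θ : ℕ → Term C) (e : Eqn C) : Eqn C := ⟨e.lhs.subst θ, e.rhs.subst θ⟩

def Atom.subst (θ : ℕ → Term C) (a : Atom C Q) : Atom C Q := ⟨a.name, a.args.map (Term.subst θ)⟩

def Constraint.subst (θ : ℕ → Term C) : Constraint C Q → Constraint C Q
  | .user a => .user (a.subst θ)
  | .builtin e => .builtin (e.subst θ)

/-! ## The constraint theory: equality on the Herbrand universe -/

def Term.eval (ν : ℕ → C) : Term C → C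
  | .var x => ν x
  | .const a => a

/-- The valuation `ν` satisfies the conjunction `B` of equations. -/
def Satisfies (ν : ℕ → C) (B : List (Eqn C)) : Prop := ∀ e ∈ B, e.lhs.eval ν = e.rhs.eval ν

/-- `CT ⊨ B → ∃_{-W} D`, where all variables outside `W` are existentially quantified in `D`. -/
def EntailsExists (B : List (Eqn C)) (W : Set ℕ) (D : List (Eqn C)) : Prop :=
  ∀ ν : ℕ → C, Satisfies ν B → ∃ ν' : ℕ → C, (∀ x ∈ W, ν' x = ν x) ∧ Satisfies ν' D

/-! ## The abstract operational semantics -/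

/-- A configuration `⟨goal, store, builtins⟩_next`: the constraints still to be solved, the
identified CHR constraints `c#i` (pairs `(c, i)`), the built-in store (a conjunction of equations),
and the next free identifier. -/
structure Config (C Q : Type*) where
  goal : Multiset (Constraint C Q)
  store : Finset (Atom C Q × ℕ)
  builtins : List (Eqn C)
  next : ℕ

/-- All variables occurring in a configuration. -/
def Config.vars (s : Config C Q) : Set ℕ :=
  {x | ∃ c ∈ s.goal, x ∈ c.vars} ∪ {x | ∃ p ∈ s.store, x ∈ p.1.vars} ∪ eqnVars s.builtins

/-- The equations `t₁ = u₁, …, tₙ = uₙ` between the arguments of two atoms of equal length. -/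
def Atom.equations (a b : Atom C Q) : List (Eqn C) := List.zipWith Eqn.mk a.args b.args

/-- The equations between the members of two lists of atoms, taken in order. -/
def equations (l₁ l₂ : List (Atom C Q)) : List (Eqn C) :=
  (List.zipWith Atom.equations l₁ l₂).flatten

/-- The two usual ways of matching heads against the CHR store: the instantiated heads are
identical to the matched constraints, or they are equal to them in every solution of the built-in
store. -/
inductive Matching where
  | syntactic
  | moduloStore

/-- The applicability condition of **Apply** in the configuration `s`, for the rule `r`, the
substitution `θ` and the matched constraints `H₁` (kept) and `H₂` (removed), without identifiers.
Here `E` states that the matched constraints equal the instantiated heads.  The substitution takes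
the variables of the head to arguments of matched constraints, and takes the variables of the
rule that are not in its head (there are none in a range-restricted rule) to distinct fresh
variables: the rule is renamed apart. -/
def Matching.Applicable (m : Matching) (s : Config C Q) (r : Rule C Q) (θ : ℕ → Term C)
    (H₁ H₂ : List (Atom C Q)) : Prop :=
  let heads := (r.kept ++ r.removed).map (Atom.subst θ)
  let E := equations (H₁ ++ H₂) heads
  H₁.length = r.kept.length ∧ H₂.length = r.removed.length ∧
  (∀ x ∈ r.headVars, ∃ a ∈ H₁ ++ H₂, θ x ∈ a.args) ∧
  (∃ ρ : ℕ → ℕ, Set.InjOn ρ ((r.bodyVars ∪ r.guardVars) \ r.headVars) ∧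
    ∀ x ∈ (r.bodyVars ∪ r.guardVars) \ r.headVars, θ x = Term.var (ρ x) ∧ ρ x ∉ s.vars) ∧
  match m with
  | .syntactic =>
      H₁ ++ H₂ = heads ∧
      EntailsExists s.builtins (eqnVars s.builtins) (E ++ r.guard.map (Eqn.subst θ))
  | .moduloStore =>
      List.Forall₂ (fun a b => a.name = b.name ∧ a.args.length = b.args.length) (H₁ ++ H₂) heads ∧
      EntailsExists s.builtins s.vars (E ++ r.guard.map (Eqn.subst θ))

/-- The transition relation of the abstract semantics of the program `P`. -/
inductive Step [DecidableEq C] [DecidableEq Q] (m : Matching) (P : Program C Q) :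
    Config C Q → Config C Q → Prop
  | solve (e : Eqn C) (G : Multiset (Constraint C Q)) (S : Finset (Atom C Q × ℕ))
      (B : List (Eqn C)) (n : ℕ) :
      Step m P ⟨.builtin e ::ₘ G, S, B, n⟩ ⟨G, S, e :: B, n⟩
  | introduce (a : Atom C Q) (G : Multiset (Constraint C Q)) (S : Finset (Atom C Q × ℕ))
      (B : List (Eqn C)) (n : ℕ) :
      Step m P ⟨.user a ::ₘ G, S, B, n⟩ ⟨G, insert (a, n) S, B, n + 1⟩
  | apply (r : Rule C Q) (hr : r ∈ P) (θ : ℕ → Term C) (H₁ H₂ : List (Atom C Q × ℕ))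
      (G : Multiset (Constraint C Q)) (S : Finset (Atom C Q × ℕ)) (B : List (Eqn C)) (n : ℕ)
      (hnodup : (H₁ ++ H₂).Nodup) (hdisj : ∀ p ∈ H₁ ++ H₂, p ∉ S)
      (happ : m.Applicable ⟨G, (H₁ ++ H₂).toFinset ∪ S, B, n⟩ r θ
        (H₁.map Prod.fst) (H₂.map Prod.fst)) :
      Step m P ⟨G, (H₁ ++ H₂).toFinset ∪ S, B, n⟩
        ⟨((r.body.map (Constraint.subst θ) : List (Constraint C Q)) : Multiset _) + G,
          H₁.toFinset ∪ S,
          equations ((H₁ ++ H₂).map Prod.fst) ((r.kept ++ r.removed).map (Atom.subst θ)) ++ B, n⟩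

/-- The initial configuration `⟨G, ∅, true⟩₁` of a goal. -/
def initial (G : Goal C Q) : Config C Q := ⟨(G : Multiset (Constraint C Q)), ∅, [], 1⟩

/-- The built-in store is (equivalent to) `false`. -/
def Config.Failed (s : Config C Q) : Prop := ¬ ∃ ν : ℕ → C, Satisfies ν s.builtins

/-- Final configurations: the failed ones, and those with an empty goal to which no rule
applies. -/
def Config.Final [DecidableEq C] [DecidableEq Q] (m : Matching) (P : Program C Q)
    (s : Config C Q) : Prop :=
  s.Failed ∨ (s.goal = 0 ∧ ∀ s', ¬ Step m P s s')

/-- The goal `G` has an infinite computation in `P`: an infinite sequence of transitions from the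
initial configuration that never reaches a final configuration. -/
def HasInfiniteComputation [DecidableEq C] [DecidableEq Q] (m : Matching) (P : Program C Q)
    (G : Goal C Q) : Prop :=
  ∃ s : ℕ → Config C Q, s 0 = initial G ∧ ∀ i, ¬ (s i).Final m P ∧ Step m P (s i) (s (i + 1))

end CHR

/-!
A program and a goal mention finitely many terms and predicate symbols, and for a range-restricted
program no transition creates a term that is not among them: there are no function symbols, and
every variable of a guard or a body is instantiated by an argument of a matched constraint. Up to
the names of the identifiers, a configuration is therefore a pair of multisets (the goal and the
CHR store) over a finite set of constraints, with a built-in store whose equations are drawn from a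
finite set. These *states* are compared by inclusion of the two multisets and equality of the sets
of equations, which is a well-quasi-order by Dickson's lemma (`exists_lt_state_le`).

Transitions are monotone for this order (`exists_successors_of_le`): they need only the presence of
constraints, and the applicability of a rule depends on nothing in the rest of the configuration
but the set of equations in the built-in store. So a path that ends above its starting point can
be repeated for ever, and an infinite run always contains such a path. If there is no infinite
run, then by König's lemma some level of the finitely branching tree of runs is empty. A search for
either witness decides which case holds (`exists_computable_hasRun`). Substitutions are encoded so
that the transition system on states stays over a finite set of terms for arbitrary programs; the
search terminates on them as well, and range restriction is used only to relate states to
configurations (`hasInfiniteComputation_iff_hasRun`).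

The successors of a state have to be computable. This rests on a decision of entailment between
conjunctions of equations: the equations are solved into a list of replacements, and over at least
two constants an equation is entailed if and only if its sides have the same normal form
(`forall_eval_eq_iff`). The entailment with existentially quantified variables holds if and only if
the conclusion identifies no terms of the premise or constants that the premise does not identify
(`entailsExists_iff`). Over a single constant everything is entailed.
-/

namespace CHR

/-! ### Infinite runs of well-structured transition systems -/

section WellStructured

variable {ι σ : Type*}

/-- The states reached from `a` by exactly `n` steps of the transition system in which `next b`
lists the successors of `b`. -/
def level (next : σ → List σ) (a : σ) (n : ℕ) : List σ :=
  Nat.rec [a] (fun _ l => l.flatMap next) n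

/-- An infinite run from `a`. -/
def HasRun (next : σ → List σ) (a : σ) : Prop :=
  ∃ f : ℕ → σ, f 0 = a ∧ ∀ n, f (n + 1) ∈ next (f n)

variable {next : σ → List σ}

theorem level_succ (a : σ) (n : ℕ) : level next a (n + 1) = (level next a n).flatMap next := rfl

theorem mem_level_succ {a b : σ} {n : ℕ} :
    b ∈ level next a (n + 1) ↔ ∃ c ∈ next a, b ∈ level next c n := by
  induction n generalizing b with
  | zero => simp [level]
  | succ n ih =>
    rw [level_succ, List.mem_flatMap]
    constructor
    · rintro ⟨d, hd, hb⟩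
      obtain ⟨c, hc, hd⟩ := ih.1 hd
      exact ⟨c, hc, List.mem_flatMap.2 ⟨d, hd, hb⟩⟩
    · rintro ⟨c, hc, hb⟩
      obtain ⟨d, hd, hb⟩ := List.mem_flatMap.1 hb
      exact ⟨d, ih.2 ⟨c, hc, hd⟩, hb⟩

/-- An empty level is followed by empty levels only. -/
theorem level_eq_nil_mono {a : σ} {m n : ℕ} (h : m ≤ n) (hm : level next a m = []) :
    level next a n = [] := by
  induction h with
  | refl => exact hm
  | step _ ih => rw [level_succ, ih, List.flatMap_nil]

theorem mem_level_of_run {f : ℕ → σ} (hf : ∀ n, f (n + 1) ∈ next (f n)) (m n : ℕ) :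
    f (m + n) ∈ level next (f m) n := by
  induction n with
  | zero => simp [level]
  | succ n ih => exact List.mem_flatMap.2 ⟨_, ih, hf _⟩

theorem hasRun_of_forall_exists {p : σ → Prop} (hp : ∀ a, p a → ∃ b ∈ next a, p b) {a : σ}
    (ha : p a) : HasRun next a := by
  choose g hg hpg using hp
  let f : ℕ → {a // p a} := fun n => Nat.rec ⟨a, ha⟩ (fun _ b => ⟨g b.1 b.2, hpg b.1 b.2⟩) n
  exact ⟨fun n => (f n).1, rfl, fun n => hg _ _⟩

/-- König's lemma for a finitely branching system. -/
theorem hasRun_of_level_ne_nil {a : σ} (ha : ∀ n, level next a n ≠ []) : HasRun next a := by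
  refine hasRun_of_forall_exists (p := fun a => ∀ n, level next a n ≠ []) (fun a ha => ?_) ha
  by_contra! hdead
  choose! k hk using hdead
  refine ha ((((next a).map k).sum) + 1) (List.eq_nil_iff_forall_not_mem.2 fun b hb => ?_)
  obtain ⟨c, hc, hb⟩ := mem_level_succ.1 hb
  rw [level_eq_nil_mono (List.single_le_sum (by simp) _ (List.mem_map_of_mem hc)) (hk c hc)] at hb
  simp at hb

/-- In a monotone system a path from `a` to some `b` above `a` can be repeated for ever. -/
theorem hasRun_of_self_covering {le : σ → σ → Prop} (hrefl : ∀ a, le a a)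
    (htrans : ∀ a b c, le a b → le b c → le a c)
    (hmono : ∀ a b a', le a b → a' ∈ next a → ∃ b' ∈ next b, le a' b')
    {a b : σ} {k : ℕ} (hb : b ∈ level next a (k + 1)) (hab : le a b) : HasRun next a := by
  -- The set of states that lie above a state of the path strictly before its end never blocks.
  refine hasRun_of_forall_exists (p := fun u => ∃ v j, le v u ∧ b ∈ level next v (j + 1))
    (fun u => ?_) ⟨a, k, hrefl a, hb⟩
  rintro ⟨v, j, hvu, hv⟩
  obtain ⟨v', hv', hbv'⟩ := mem_level_succ.1 hv
  obtain ⟨u', hu', hvu'⟩ := hmono _ _ _ hvu hv'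
  refine ⟨u', hu', ?_⟩
  cases j with
  | succ j => exact ⟨v', j, hvu', hbv'⟩
  | zero =>
    obtain rfl : b = v' := by simpa [level] using hbv'
    exact ⟨a, k, htrans _ _ _ hab hvu', hb⟩

theorem HasRun.prepend {a b : σ} {n : ℕ} (hb : b ∈ level next a n) (h : HasRun next b) :
    HasRun next a := by
  induction n generalizing a with
  | zero =>
    obtain rfl : b = a := by simpa [level] using hb
    exact h
  | succ n ih =>
    obtain ⟨c, hc, hb⟩ := mem_level_succ.1 hb
    obtain ⟨f, rfl, hf⟩ := ih hb
    exact ⟨fun n => Nat.casesOn n a f, rfl, fun n => by cases n <;> simp_all⟩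

theorem primrec_level [Primcodable ι] [Primcodable σ] {next : ι → σ → List σ}
    (hnext : Primrec₂ next) :
    Primrec₂ fun (p : ι × σ) (n : ℕ) => level (next p.1) p.2 n := by
  refine Primrec.nat_rec (f := fun p : ι × σ => [p.2])
    (g := fun p q => q.2.flatMap (next p.1)) ?_ ?_
  · exact Primrec.list_cons.comp Primrec.snd (Primrec.const [])
  · exact Primrec.list_flatMap (Primrec.snd.comp Primrec.snd)
      (hnext.comp (Primrec.fst.comp (Primrec.fst.comp Primrec.fst)) Primrec.snd).to₂

theorem primrecPred_exists_mem {α β : Type*} [Primcodable α] [Primcodable β]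
    {f : α → List β} {p : α → β → Prop} (hf : Primrec f)
    (hp : PrimrecPred fun q : α × β => p q.1 q.2) :
    PrimrecPred fun a => ∃ b ∈ f a, p a b :=
  (PrimrecRel.exists_mem_list (R := fun b a => p a b) (PrimrecRel.swap (r := p) hp)).comp hf
    Primrec.id

theorem primrecPred_forall_mem {α β : Type*} [Primcodable α] [Primcodable β]
    {f : α → List β} {p : α → β → Prop} (hf : Primrec f)
    (hp : PrimrecPred fun q : α × β => p q.1 q.2) :
    PrimrecPred fun a => ∀ b ∈ f a, p a b :=
  (PrimrecRel.forall_mem_list (R := fun b a => p a b) (PrimrecRel.swap (r := p) hp)).comp hf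
    Primrec.id

/-- The existence of an infinite run is decidable for uniformly given well-structured systems: a
system without one has an empty level, and a system with one has a path that ends above its
starting point. Both can be found by search. -/
theorem exists_computable_hasRun [Primcodable ι] [Primcodable σ] {start : ι → σ}
    {next : ι → σ → List σ} {le : σ → σ → Prop} (hstart : Primrec start) (hnext : Primrec₂ next)
    (hle : PrimrecRel le) (hrefl : ∀ a, le a a) (htrans : ∀ a b c, le a b → le b c → le a c)
    (hmono : ∀ i a b a', le a b → a' ∈ next i a → ∃ b' ∈ next i b, le a' b')
    (hwqo : ∀ i (f : ℕ → σ), f 0 = start i → (∀ n, f (n + 1) ∈ next i (f n)) →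
      ∃ m n, m < n ∧ le (f m) (f n)) :
    ∃ d : ι → Bool, Computable d ∧ ∀ i, d i = true ↔ HasRun (next i) (start i) := by
  classical
  let dead : ι × ℕ → Prop := fun p => level (next p.1) (start p.1) p.2 = []
  -- The number `p.2` codes the number of steps to `a` and, less one, that from `a` to `b`.
  let cover : ι × ℕ → Prop := fun p =>
    ∃ a ∈ level (next p.1) (start p.1) p.2.unpair.1,
      ∃ b ∈ level (next p.1) a (p.2.unpair.2 + 1), le a b
  let test : ι → ℕ → Option Bool := fun i n =>
    if dead (i, n) then some false else if cover (i, n) then some true else none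
  have hlevel := primrec_level hnext
  have hdead : PrimrecPred dead :=
    Primrec.eq.comp (hlevel.comp (Primrec.pair Primrec.fst (hstart.comp Primrec.fst)) Primrec.snd)
      (Primrec.const [])
  have hcover : PrimrecPred cover := by
    refine primrecPred_exists_mem (hlevel.comp
      (Primrec.pair Primrec.fst (hstart.comp Primrec.fst))
      (Primrec.fst.comp (Primrec.unpair.comp Primrec.snd))) ?_
    refine primrecPred_exists_mem (hlevel.comp
      (Primrec.pair (Primrec.fst.comp Primrec.fst) Primrec.snd)
      (Primrec.succ.comp (Primrec.snd.comp (Primrec.unpair.comp (Primrec.snd.comp Primrec.fst)))))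
      ?_
    exact hle.comp (Primrec.snd.comp Primrec.fst) Primrec.snd
  have htest : Primrec₂ test :=
    Primrec.ite hdead (Primrec.const _) (Primrec.ite hcover (Primrec.const _) (Primrec.const _))
  have not_run {i n} (h : dead (i, n)) : ¬ HasRun (next i) (start i) := by
    rintro ⟨f, hf0, hf⟩
    have := mem_level_of_run hf 0 n
    rw [hf0, h] at this
    simp at this
  have run {i n} (h : cover (i, n)) : HasRun (next i) (start i) := by
    obtain ⟨a, ha, b, hb, hab⟩ := h
    exact (hasRun_of_self_covering hrefl htrans (hmono i) hb hab).prepend ha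
  have total (i) : (Nat.rfindOpt (test i)).Dom := by
    rw [Nat.rfindOpt_dom]
    by_cases h : HasRun (next i) (start i)
    · obtain ⟨f, hf0, hf⟩ := h
      obtain ⟨m, n, hmn, hle⟩ := hwqo i f hf0 hf
      obtain ⟨k, rfl⟩ := Nat.exists_eq_add_of_lt hmn
      refine ⟨Nat.pair m k, true, ?_⟩
      have hc : cover (i, Nat.pair m k) := by
        refine ⟨f m, ?_, f (m + k + 1), ?_, hle⟩
        · simpa [hf0] using mem_level_of_run hf 0 m
        · simpa [add_assoc] using mem_level_of_run hf m (k + 1)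
      have hd : ¬ dead (i, Nat.pair m k) := fun hd => not_run hd ⟨f, hf0, hf⟩
      simp [test, hc, hd]
    · have : ∃ n, dead (i, n) := by
        by_contra! hn
        exact h (hasRun_of_level_ne_nil hn)
      obtain ⟨n, hn⟩ := this
      exact ⟨n, false, by simp [test, hn]⟩
  refine ⟨fun i => (Nat.rfindOpt (test i)).get (total i), ?_, fun i => ?_⟩
  · exact (Partrec.rfindOpt htest.to_comp).of_eq fun i => (Part.some_get (total i)).symm
  · beta_reduce
    obtain ⟨n, hn⟩ := Nat.rfindOpt_spec (Part.get_mem (total i))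
    generalize (Nat.rfindOpt (test i)).get (total i) = v at hn ⊢
    by_cases hd : dead (i, n)
    · have : v = false := by simpa [test, hd, eq_comm] using hn
      simp [this, not_run hd]
    · by_cases hc : cover (i, n)
      · have : v = true := by simpa [test, hd, hc, eq_comm] using hn
        simp [this, run hc]
      · simp [test, hd, hc] at hn

end WellStructured

/-! ### Primitive recursion on the syntax -/

section PrimrecSyntax

variable {C Q α : Type*} [Primcodable C] [Primcodable Q] [Primcodable α]

theorem primrec_term_var : Primrec (Term.var : ℕ → Term C) :=
  (Primrec.of_equiv_symm (e := termEquiv)).comp Primrec.sumInl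

theorem primrec_term_const : Primrec (Term.const : C → Term C) :=
  (Primrec.of_equiv_symm (e := termEquiv)).comp Primrec.sumInr

theorem primrec_term_casesOn {β : Type*} [Primcodable β] {t : α → Term C} {f : α → ℕ → β}
    {g : α → C → β} (ht : Primrec t) (hf : Primrec₂ f) (hg : Primrec₂ g) :
    Primrec fun a => (Term.casesOn (t a) (f a) (g a) : β) :=
  (Primrec.sumCasesOn ((Primrec.of_equiv (e := termEquiv)).comp ht) hf hg).of_eq fun a => by
    cases t a <;> rfl

theorem primrec_eqn_mk : Primrec₂ (Eqn.mk : Term C → Term C → Eqn C) :=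
  (Primrec.of_equiv_symm (e := eqnEquiv)).to₂

theorem primrec_eqn_lhs : Primrec (Eqn.lhs : Eqn C → Term C) :=
  Primrec.fst.comp (Primrec.of_equiv (e := eqnEquiv))

theorem primrec_eqn_rhs : Primrec (Eqn.rhs : Eqn C → Term C) :=
  Primrec.snd.comp (Primrec.of_equiv (e := eqnEquiv))

theorem primrec_atom_mk : Primrec₂ (Atom.mk : Q → List (Term C) → Atom C Q) :=
  (Primrec.of_equiv_symm (e := atomEquiv)).to₂

theorem primrec_atom_name : Primrec (Atom.name : Atom C Q → Q) :=
  Primrec.fst.comp (Primrec.of_equiv (e := atomEquiv))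

theorem primrec_atom_args : Primrec (Atom.args : Atom C Q → List (Term C)) :=
  Primrec.snd.comp (Primrec.of_equiv (e := atomEquiv))

theorem primrec_constraint_user : Primrec (Constraint.user : Atom C Q → Constraint C Q) :=
  (Primrec.of_equiv_symm (e := constraintEquiv)).comp Primrec.sumInl

theorem primrec_constraint_builtin : Primrec (Constraint.builtin : Eqn C → Constraint C Q) :=
  (Primrec.of_equiv_symm (e := constraintEquiv)).comp Primrec.sumInr

theorem primrec_constraint_casesOn {β : Type*} [Primcodable β] {c : α → Constraint C Q}
    {f : α → Atom C Q → β} {g : α → Eqn C → β} (hc : Primrec c) (hf : Primrec₂ f)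
    (hg : Primrec₂ g) : Primrec fun a => (Constraint.casesOn (c a) (f a) (g a) : β) :=
  (Primrec.sumCasesOn ((Primrec.of_equiv (e := constraintEquiv)).comp hc) hf hg).of_eq
    fun a => by cases c a <;> rfl

theorem primrec_rule_kept : Primrec (Rule.kept : Rule C Q → List (Atom C Q)) :=
  Primrec.fst.comp (Primrec.fst.comp (Primrec.of_equiv (e := ruleEquiv)))

theorem primrec_rule_removed : Primrec (Rule.removed : Rule C Q → List (Atom C Q)) :=
  Primrec.snd.comp (Primrec.fst.comp (Primrec.of_equiv (e := ruleEquiv)))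

theorem primrec_rule_guard : Primrec (Rule.guard : Rule C Q → List (Eqn C)) :=
  Primrec.fst.comp (Primrec.snd.comp (Primrec.of_equiv (e := ruleEquiv)))

theorem primrec_rule_body : Primrec (Rule.body : Rule C Q → List (Constraint C Q)) :=
  Primrec.snd.comp (Primrec.snd.comp (Primrec.of_equiv (e := ruleEquiv)))

theorem primrec_zipWith {β γ δ : Type*} [Primcodable β] [Primcodable γ] [Primcodable δ]
    {f : β → γ → δ} (hf : Primrec₂ f) : Primrec₂ (List.zipWith f) := by
  -- The fold carries the part of the second list that is still to be consumed.
  let step : (List β × List γ) → (List δ × List γ) × β → List δ × List γ := fun _ q =>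
    (q.1.2.head?.elim q.1.1 (fun c => q.1.1 ++ [f q.2 c]), q.1.2.tail)
  have hstep : Primrec₂ step := by
    have h1 := Primrec.fst.comp (Primrec.snd (α := List β × List γ) (β := (List δ × List γ) × β))
    refine Primrec.pair ?_ (Primrec.list_tail.comp (Primrec.snd.comp h1))
    refine (Primrec.option_casesOn (σ := List δ)
      (o := fun q : (List β × List γ) × (List δ × List γ) × β => q.2.1.2.head?)
      (f := fun q => q.2.1.1) (g := fun q c => q.2.1.1 ++ [f q.2.2 c])
      (Primrec.list_head?.comp (Primrec.snd.comp h1)) (Primrec.fst.comp h1) ?_).of_eq fun q => ?_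
    · exact Primrec.list_concat.comp (Primrec.fst.comp (h1.comp Primrec.fst))
        (hf.comp (Primrec.snd.comp (Primrec.snd.comp Primrec.fst)) Primrec.snd)
    · cases q.2.1.2.head? <;> rfl
  have hfold := Primrec.fst.comp (Primrec.list_foldl Primrec.fst
    (Primrec.pair (Primrec.const []) Primrec.snd) hstep)
  have spec (p : List β × List γ) (l : List β) (acc : List δ) (m : List γ) :
      (l.foldl (fun s b => step p (s, b)) (acc, m)).1 = acc ++ List.zipWith f l m := by
    induction l generalizing acc m with
    | nil => simp
    | cons b l ih => cases m <;> simp [step, ih]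
  exact hfold.of_eq fun p => by rw [spec p]; rfl

end PrimrecSyntax

/-! ### Solving equations between variables and constants -/

section Unification

variable {C : Type*}

/-- The conjunction `B` has a solution in the Herbrand universe. -/
def Satisfiable (B : List (Eqn C)) : Prop := ∃ ν : ℕ → C, Satisfies ν B

theorem satisfies_nil (ν : ℕ → C) : Satisfies ν [] := fun _ h => absurd h (by simp)

theorem satisfies_cons {ν : ℕ → C} {e : Eqn C} {B : List (Eqn C)} :
    Satisfies ν (e :: B) ↔ e.lhs.eval ν = e.rhs.eval ν ∧ Satisfies ν B := by
  simp [Satisfies]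

theorem satisfies_append {ν : ℕ → C} {B D : List (Eqn C)} :
    Satisfies ν (B ++ D) ↔ Satisfies ν B ∧ Satisfies ν D := by
  simp [Satisfies, or_imp, forall_and]

theorem satisfies_of_subsingleton [Subsingleton C] (ν : ℕ → C) (B : List (Eqn C)) :
    Satisfies ν B := fun _ _ => Subsingleton.elim _ _

theorem mem_vars_iff {t : Term C} {x : ℕ} : x ∈ t.vars ↔ t = .var x := by
  cases t <;> simp [Term.vars, eq_comm]

/-- Two constants suffice to separate distinct terms. -/
theorem exists_eval_ne [Nontrivial C] {t u : Term C} (h : t ≠ u) :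
    ∃ ν : ℕ → C, t.eval ν ≠ u.eval ν := by
  classical
  obtain ⟨a, b, hab⟩ := exists_pair_ne C
  have aux (x : ℕ) (c : C) : ∃ ν : ℕ → C, ν x ≠ c :=
    (exists_ne c).imp' (fun d _ => d) fun _ hd => hd
  cases t with
  | var x =>
    cases u with
    | var y =>
      have hxy : x ≠ y := fun hxy => h (hxy ▸ rfl)
      exact ⟨Function.update (fun _ => a) y b, by simpa [Term.eval, hxy] using hab⟩
    | const c => exact aux x c
  | const c =>
    cases u with
    | var y => exact (aux y c).imp fun _ h => h.symm
    | const d => exact ⟨fun _ => a, fun hcd => h (congrArg _ hcd)⟩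

/-- The two sides of the equations of `B`. -/
def sides (B : List (Eqn C)) : List (Term C) := B.flatMap fun e => [e.lhs, e.rhs]

/-- The term is a constant. -/
def Term.IsConst : Term C → Prop
  | .var _ => False
  | .const _ => True

theorem var_mem_sides {B : List (Eqn C)} {x : ℕ} : Term.var x ∈ sides B ↔ x ∈ eqnVars B := by
  simp [sides, eqnVars, Eqn.vars, mem_vars_iff, eq_comm]

theorem lhs_mem_sides {B : List (Eqn C)} {e : Eqn C} (he : e ∈ B) : e.lhs ∈ sides B :=
  List.mem_flatMap.2 ⟨e, he, by simp⟩

theorem rhs_mem_sides {B : List (Eqn C)} {e : Eqn C} (he : e ∈ B) : e.rhs ∈ sides B :=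
  List.mem_flatMap.2 ⟨e, he, by simp⟩

theorem satisfiable_iff_entailsExists_nil [Nonempty C] {B : List (Eqn C)} :
    Satisfiable B ↔ EntailsExists [] (eqnVars ([] : List (Eqn C))) B := by
  constructor
  · rintro ⟨ν', h⟩ ν -
    exact ⟨ν', fun x hx => by simp [eqnVars] at hx, h⟩
  · intro h
    obtain ⟨ν, -, hν⟩ := h (fun _ => Classical.arbitrary C) (satisfies_nil _)
    exact ⟨ν, hν⟩

variable [DecidableEq C]

/-- Replace the term `p.1` by `p.2`. -/
def replaceTerm (p : Term C × Term C) (t : Term C) : Term C := if t = p.1 then p.2 else t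

/-- Perform a list of replacements, starting from the last one. -/
def replaceTerms (b : List (Term C × Term C)) (t : Term C) : Term C := b.foldr replaceTerm t

/-- The replacement that identifies two terms. A constant is replaced only if both terms are
constants. -/
def orient (t u : Term C) : Term C × Term C :=
  match t with
  | .var _ => (t, u)
  | .const _ => (u, t)

/-- A solved form of a conjunction of equations: a list of replacements under which both sides of
each equation become identical. -/
def solvedForm (B : List (Eqn C)) : List (Term C × Term C) :=
  B.foldr (fun e b => orient (replaceTerms b e.lhs) (replaceTerms b e.rhs) :: b) []

/-- The normal form of a term modulo the equations `B`. -/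
def norm (B : List (Eqn C)) (t : Term C) : Term C := replaceTerms (solvedForm B) t

theorem norm_cons (e : Eqn C) (B : List (Eqn C)) (t : Term C) :
    norm (e :: B) t = replaceTerm (orient (norm B e.lhs) (norm B e.rhs)) (norm B t) := rfl

theorem replaceTerm_orient_eq (t u : Term C) :
    replaceTerm (orient t u) t = replaceTerm (orient t u) u := by
  cases t <;> simp [orient, replaceTerm] <;> grind

theorem eval_replaceTerm_orient {ν : ℕ → C} {t u : Term C} (h : t.eval ν = u.eval ν)
    (v : Term C) : (replaceTerm (orient t u) v).eval ν = v.eval ν := by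
  cases t <;> simp only [orient, replaceTerm] <;> split_ifs with hv <;> simp_all

theorem norm_eq_of_mem {B : List (Eqn C)} {e : Eqn C} (he : e ∈ B) :
    norm B e.lhs = norm B e.rhs := by
  induction B with
  | nil => simp at he
  | cons d B ih =>
    rw [norm_cons, norm_cons]
    rcases List.mem_cons.1 he with rfl | he
    · exact replaceTerm_orient_eq _ _
    · rw [ih he]

theorem eval_norm {ν : ℕ → C} {B : List (Eqn C)} (hν : Satisfies ν B) (t : Term C) :
    (norm B t).eval ν = t.eval ν := by
  induction B generalizing t with
  | nil => rfl
  | cons e B ih =>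
    rw [satisfies_cons] at hν
    rw [norm_cons, eval_replaceTerm_orient _ _, ih hν.2]
    rw [ih hν.2, ih hν.2, hν.1]

theorem eval_eq_of_norm_eq {ν : ℕ → C} {B : List (Eqn C)} (hν : Satisfies ν B) {t u : Term C}
    (h : norm B t = norm B u) : t.eval ν = u.eval ν := by
  rw [← eval_norm hν t, h, eval_norm hν u]

theorem norm_const {B : List (Eqn C)} (hB : Satisfiable B) (a : C) :
    norm B (.const a) = .const a := by
  obtain ⟨ν, hν⟩ := hB
  induction B with
  | nil => rfl
  | cons e B ih =>
    have hν' := (satisfies_cons.1 hν).2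
    have he := (satisfies_cons.1 hν).1
    rw [← eval_norm hν' e.lhs, ← eval_norm hν' e.rhs] at he
    rw [norm_cons, ih hν']
    generalize norm B e.lhs = l at he ⊢
    generalize norm B e.rhs = r at he ⊢
    cases l with
    | var x => simp [orient, replaceTerm]
    | const b => cases r <;> simp_all [orient, replaceTerm, Term.eval]

/-- Every valuation of the normal forms of a satisfiable conjunction gives a solution. -/
theorem satisfies_eval_norm {B : List (Eqn C)} (hB : Satisfiable B) (μ : ℕ → C) :
    Satisfies (fun x => (norm B (.var x)).eval μ) B ∧
      ∀ t : Term C, t.eval (fun x => (norm B (.var x)).eval μ) = (norm B t).eval μ := by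
  have h (t : Term C) : t.eval (fun x => (norm B (.var x)).eval μ) = (norm B t).eval μ := by
    cases t with
    | var x => rfl
    | const a => rw [norm_const hB]; rfl
  exact ⟨fun e he => by rw [h, h, norm_eq_of_mem he], h⟩

theorem forall_eval_eq_iff [Nontrivial C] {B : List (Eqn C)} (hB : Satisfiable B)
    {t u : Term C} :
    (∀ ν : ℕ → C, Satisfies ν B → t.eval ν = u.eval ν) ↔ norm B t = norm B u := by
  refine ⟨fun h => ?_, fun h ν hν => eval_eq_of_norm_eq hν h⟩
  by_contra hne
  obtain ⟨μ, hμ⟩ := exists_eval_ne hne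
  obtain ⟨hs, he⟩ := satisfies_eval_norm hB μ
  exact hμ (by rw [← he, ← he, h _ hs])

/-- A satisfiable `B` entails `D`, with the variables foreign to `B` quantified existentially, if
and only if `D` identifies no two terms of `B` or constants that are not already identified
by `B`. -/
theorem entailsExists_iff [Nontrivial C] {B D : List (Eqn C)} (hB : Satisfiable B) :
    EntailsExists B (eqnVars B) D ↔
      ∀ t ∈ sides B ++ sides D, ∀ u ∈ sides B ++ sides D,
        (t ∈ sides B ∨ t.IsConst) → (u ∈ sides B ∨ u.IsConst) →
          norm (D ++ B) t = norm (D ++ B) u → norm B t = norm B u := by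
  classical
  constructor
  · intro h t _ u _ ht hu htu
    refine (forall_eval_eq_iff hB).1 fun ν hν => ?_
    obtain ⟨ν', hW, hD⟩ := h ν hν
    have agree {v : Term C} (hv : v ∈ sides B ∨ v.IsConst) : v.eval ν' = v.eval ν := by
      cases v with
      | var x => exact hW x (var_mem_sides.1 (hv.resolve_right id))
      | const a => rfl
    have hB' : Satisfies ν' B := fun e he => by
      rw [agree (.inl (lhs_mem_sides he)), agree (.inl (rhs_mem_sides he)), hν e he]
    rw [← agree ht, ← agree hu, eval_eq_of_norm_eq (satisfies_append.2 ⟨hD, hB'⟩) htu]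
  · intro h ν hν
    -- A variable takes the value of a term of `B` or a constant in its class, if there is one.
    let rep (t : Term C) : C :=
      if h : ∃ w, w ∈ sides B ++ sides D ∧ (w ∈ sides B ∨ w.IsConst) ∧
        norm (D ++ B) w = norm (D ++ B) t then h.choose.eval ν else ν 0
    have rep_eq {t : Term C} (ht : t ∈ sides B ++ sides D) (ht' : t ∈ sides B ∨ t.IsConst) :
        rep t = t.eval ν := by
      have hex : ∃ w, w ∈ sides B ++ sides D ∧ (w ∈ sides B ∨ w.IsConst) ∧
        norm (D ++ B) w = norm (D ++ B) t := ⟨t, ht, ht', rfl⟩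
      simp only [rep, dif_pos hex]
      obtain ⟨h1, h2, h3⟩ := hex.choose_spec
      exact eval_eq_of_norm_eq hν (h _ h1 _ ht h2 ht' h3)
    have rep_congr {t u : Term C} (htu : norm (D ++ B) t = norm (D ++ B) u) : rep t = rep u := by
      simp only [rep, htu]
    have eval_rep {t : Term C} (ht : t ∈ sides B ++ sides D) :
        t.eval (fun x => rep (.var x)) = rep t := by
      cases t with
      | var x => rfl
      | const a => exact (rep_eq ht (.inr trivial)).symm
    refine ⟨fun x => rep (.var x), fun x hx => ?_, fun e he => ?_⟩
    · have := var_mem_sides.2 hx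
      exact rep_eq (List.mem_append_left _ this) (.inl this)
    · rw [eval_rep (List.mem_append_right _ (lhs_mem_sides he)),
        eval_rep (List.mem_append_right _ (rhs_mem_sides he)),
        rep_congr (norm_eq_of_mem (List.mem_append_left _ he))]

end Unification

/-! ### Deciding entailment -/

section PrimrecEntailment

variable {C : Type*} [Primcodable C]

theorem primrec_orient : Primrec₂ (orient : Term C → Term C → Term C × Term C) := by
  refine (primrec_term_casesOn (t := fun p : Term C × Term C => p.1) (f := fun p _ => p)
    (g := fun p _ => (p.2, p.1)) Primrec.fst Primrec.fst
    (Primrec.pair (Primrec.snd.comp Primrec.fst) (Primrec.fst.comp Primrec.fst))).of_eq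
    fun p => ?_
  rcases p with ⟨_ | _, _⟩ <;> rfl

theorem primrec_sides : Primrec (sides : List (Eqn C) → List (Term C)) :=
  Primrec.list_flatMap Primrec.id (Primrec.list_cons.comp (primrec_eqn_lhs.comp Primrec.snd)
    (Primrec.list_cons.comp (primrec_eqn_rhs.comp Primrec.snd) (Primrec.const []))).to₂

theorem primrecPred_isConst : PrimrecPred (Term.IsConst : Term C → Prop) := by
  refine ⟨fun t => by cases t <;> unfold Term.IsConst <;> infer_instance, ?_⟩
  refine (primrec_term_casesOn (t := fun t : Term C => t) (f := fun _ _ => false)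
    (g := fun _ _ => true) Primrec.id (Primrec.const _) (Primrec.const _)).of_eq fun t => ?_
  cases t with
  | var => exact (decide_eq_false id).symm
  | const => exact (decide_eq_true trivial).symm

theorem primrecRel_mem {α : Type*} [Primcodable α] :
    PrimrecRel fun (a : α) (l : List α) => a ∈ l := by
  refine (primrecPred_exists_mem (f := fun p : α × List α => p.2) (p := fun p b => b = p.1)
    Primrec.snd (Primrec.eq.comp Primrec.snd (Primrec.fst.comp Primrec.fst))).of_eq fun p => ?_
  simp

theorem primrecPred_imp {α : Type*} [Primcodable α] {p q : α → Prop} (hp : PrimrecPred p)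
    (hq : PrimrecPred q) : PrimrecPred fun a => p a → q a :=
  (hp.not.or hq).of_eq fun _ => imp_iff_not_or.symm

theorem primrecPred_true {α : Type*} [Primcodable α] : PrimrecPred fun _ : α => True :=
  (Primrec.eq.comp (Primrec.const (0 : ℕ)) (Primrec.const 0)).of_eq (by simp)

variable [DecidableEq C]

theorem primrec_replaceTerm : Primrec₂ (replaceTerm : Term C × Term C → Term C → Term C) :=
  Primrec.ite (Primrec.eq.comp Primrec.snd (Primrec.fst.comp Primrec.fst))
    (Primrec.snd.comp Primrec.fst) Primrec.snd

theorem primrec_replaceTerms :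
    Primrec₂ (replaceTerms : List (Term C × Term C) → Term C → Term C) :=
  Primrec.list_foldr (h := fun _ q => replaceTerm q.1 q.2) Primrec.fst Primrec.snd
    (primrec_replaceTerm.comp (Primrec.fst.comp Primrec.snd) (Primrec.snd.comp Primrec.snd)).to₂

theorem primrec_solvedForm : Primrec (solvedForm : List (Eqn C) → List (Term C × Term C)) := by
  refine Primrec.list_foldr (h := fun (_ : List (Eqn C)) (q : Eqn C × List (Term C × Term C)) =>
    orient (replaceTerms q.2 q.1.lhs) (replaceTerms q.2 q.1.rhs) :: q.2) Primrec.id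
    (Primrec.const []) ?_
  have h1 := Primrec.fst.comp (Primrec.snd (α := List (Eqn C))
    (β := Eqn C × List (Term C × Term C)))
  have h2 := Primrec.snd.comp (Primrec.snd (α := List (Eqn C))
    (β := Eqn C × List (Term C × Term C)))
  exact (Primrec.list_cons.comp (primrec_orient.comp
    (primrec_replaceTerms.comp h2 (primrec_eqn_lhs.comp h1))
    (primrec_replaceTerms.comp h2 (primrec_eqn_rhs.comp h1))) h2).to₂

theorem primrec_norm : Primrec₂ (norm : List (Eqn C) → Term C → Term C) :=
  primrec_replaceTerms.comp (primrec_solvedForm.comp Primrec.fst) Primrec.snd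

theorem primrecPred_entailment_criterion :
    PrimrecPred fun p : List (Eqn C) × List (Eqn C) =>
      ∀ t ∈ sides p.1 ++ sides p.2, ∀ u ∈ sides p.1 ++ sides p.2,
        (t ∈ sides p.1 ∨ t.IsConst) → (u ∈ sides p.1 ∨ u.IsConst) →
          norm (p.2 ++ p.1) t = norm (p.2 ++ p.1) u → norm p.1 t = norm p.1 u := by
  have hs : Primrec fun p : List (Eqn C) × List (Eqn C) => sides p.1 ++ sides p.2 :=
    Primrec.list_append.comp (primrec_sides.comp Primrec.fst) (primrec_sides.comp Primrec.snd)
  refine primrecPred_forall_mem hs (primrecPred_forall_mem (hs.comp Primrec.fst) ?_)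
  have hp := Primrec.fst.comp (Primrec.fst (α := (List (Eqn C) × List (Eqn C)) × Term C)
    (β := Term C))
  have ht := Primrec.snd.comp (Primrec.fst (α := (List (Eqn C) × List (Eqn C)) × Term C)
    (β := Term C))
  have hu := Primrec.snd (α := (List (Eqn C) × List (Eqn C)) × Term C) (β := Term C)
  have hB := Primrec.fst.comp hp
  have hDB := Primrec.list_append.comp (Primrec.snd.comp hp) hB
  refine primrecPred_imp (PrimrecPred.or (primrecRel_mem.comp ht (primrec_sides.comp hB))
    (primrecPred_isConst.comp ht)) (primrecPred_imp (PrimrecPred.or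
    (primrecRel_mem.comp hu (primrec_sides.comp hB)) (primrecPred_isConst.comp hu))
    (primrecPred_imp (Primrec.eq.comp (primrec_norm.comp hDB ht) (primrec_norm.comp hDB hu))
      (Primrec.eq.comp (primrec_norm.comp hB ht) (primrec_norm.comp hB hu))))

variable [Nonempty C]

theorem primrecPred_satisfiable : PrimrecPred (Satisfiable : List (Eqn C) → Prop) := by
  rcases subsingleton_or_nontrivial C with _ | _
  · exact primrecPred_true.of_eq fun B =>
      iff_of_true trivial ⟨fun _ => Classical.arbitrary C, satisfies_of_subsingleton _ _⟩
  · refine (primrecPred_entailment_criterion.comp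
      (Primrec.pair (Primrec.const []) Primrec.id)).of_eq fun B => ?_
    rw [satisfiable_iff_entailsExists_nil,
      entailsExists_iff ⟨fun _ => Classical.arbitrary C, satisfies_nil _⟩]
    rfl

theorem primrecRel_entailsExists :
    PrimrecRel fun B D : List (Eqn C) => Satisfiable B ∧ EntailsExists B (eqnVars B) D := by
  rcases subsingleton_or_nontrivial C with _ | _
  · refine primrecPred_true.of_eq fun p => iff_of_true trivial
      ⟨⟨fun _ => Classical.arbitrary C, satisfies_of_subsingleton _ _⟩, ?_⟩
    exact fun ν _ => ⟨ν, fun _ _ => rfl, satisfies_of_subsingleton _ _⟩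
  · exact ((primrecPred_satisfiable.comp Primrec.fst).and
      primrecPred_entailment_criterion).of_eq fun p =>
        and_congr_right fun h => (entailsExists_iff h).symm

theorem primrecRel_entails :
    PrimrecRel fun B D : List (Eqn C) => Satisfiable B ∧ ∀ ν, Satisfies ν B → Satisfies ν D := by
  rcases subsingleton_or_nontrivial C with _ | _
  · exact primrecPred_true.of_eq fun p => iff_of_true trivial
      ⟨⟨fun _ => Classical.arbitrary C, satisfies_of_subsingleton _ _⟩,
        fun ν _ => satisfies_of_subsingleton _ _⟩
  · refine ((primrecPred_satisfiable.comp Primrec.fst).and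
      (primrecPred_forall_mem (f := fun p : List (Eqn C) × List (Eqn C) => p.2)
        (p := fun p e => norm p.1 e.lhs = norm p.1 e.rhs) Primrec.snd ?_)).of_eq fun p =>
        and_congr_right fun h => ?_
    · have h := Primrec.fst.comp (Primrec.fst (α := List (Eqn C) × List (Eqn C)) (β := Eqn C))
      exact Primrec.eq.comp (primrec_norm.comp h (primrec_eqn_lhs.comp Primrec.snd))
        (primrec_norm.comp h (primrec_eqn_rhs.comp Primrec.snd))
    · simp only [← forall_eval_eq_iff h, Satisfies]
      exact ⟨fun H ν hν e he => H e he ν hν, fun H e he ν hν => H ν hν e he⟩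

end PrimrecEntailment

/-! ### Enumerating selections and assignments -/

section Selections

variable {α : Type*}

/-- All ways to select a member of a list, with the list of the remaining members. -/
def selections : List α → List (α × List α)
  | [] => []
  | a :: l => (a, l) :: (selections l).map fun p => (p.1, a :: p.2)

/-- All ways to select `n` members of a list in some order, with the list of the remaining
members. -/
def multiSelections (n : ℕ) (l : List α) : List (List α × List α) :=
  Nat.rec [([], l)] (fun _ ps => ps.flatMap fun q =>
    (selections q.2).map fun p => (q.1 ++ [p.1], p.2)) n

theorem perm_of_mem_selections {a : α} {l r : List α} (h : (a, r) ∈ selections l) :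
    l.Perm (a :: r) := by
  induction l generalizing r with
  | nil => simp [selections] at h
  | cons b l ih =>
    simp only [selections, List.mem_cons, Prod.mk.injEq, List.mem_map, Prod.exists] at h
    obtain ⟨rfl, rfl⟩ | ⟨c, r', h, rfl, rfl⟩ := h
    · rfl
    · exact ((ih h).cons b).trans (List.Perm.swap ..)

theorem exists_mem_selections_of_perm {a : α} {l r : List α} (h : l.Perm (a :: r)) :
    ∃ r', (a, r') ∈ selections l ∧ r'.Perm r := by
  have aux (l : List α) (h : a ∈ l) : ∃ r', (a, r') ∈ selections l := by
    induction l with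
    | nil => simp at h
    | cons b l ih =>
      rcases List.mem_cons.1 h with rfl | h
      · exact ⟨l, by simp [selections]⟩
      · obtain ⟨r', h⟩ := ih h
        exact ⟨b :: r', List.mem_cons_of_mem _ (List.mem_map.2 ⟨_, h, rfl⟩)⟩
  obtain ⟨r', hr'⟩ := aux l (h.mem_iff.2 (by simp))
  exact ⟨r', hr', List.Perm.cons_inv ((perm_of_mem_selections hr').symm.trans h)⟩

theorem mem_multiSelections_succ {n : ℕ} {l h r : List α} :
    (h, r) ∈ multiSelections (n + 1) l ↔
      ∃ h' r' a, (h', r') ∈ multiSelections n l ∧ (a, r) ∈ selections r' ∧ h = h' ++ [a] := by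
  simp only [multiSelections, List.mem_flatMap, List.mem_map, Prod.mk.injEq, Prod.exists]
  constructor
  · rintro ⟨h', r', h1, a, r'', h2, rfl, rfl⟩
    exact ⟨h', r', a, h1, h2, rfl⟩
  · rintro ⟨h', r', a, h1, h2, rfl⟩
    exact ⟨h', r', h1, a, r, h2, rfl, rfl⟩

theorem perm_of_mem_multiSelections {n : ℕ} {l h r : List α} (H : (h, r) ∈ multiSelections n l) :
    h.length = n ∧ l.Perm (h ++ r) := by
  induction n generalizing h r with
  | zero =>
    obtain ⟨rfl, rfl⟩ : h = [] ∧ r = l := by simpa [multiSelections] using H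
    simp
  | succ n ih =>
    obtain ⟨h', r', a, h1, h2, rfl⟩ := mem_multiSelections_succ.1 H
    obtain ⟨rfl, hp⟩ := ih h1
    refine ⟨by simp, hp.trans ?_⟩
    simpa using (perm_of_mem_selections h2).append_left h'

theorem exists_mem_multiSelections_of_perm {l h r : List α} (H : l.Perm (h ++ r)) :
    ∃ r', (h, r') ∈ multiSelections h.length l ∧ r'.Perm r := by
  induction h using List.reverseRecOn generalizing r with
  | nil => exact ⟨l, by simp [multiSelections], by simpa using H⟩
  | append_singleton h a ih =>
    obtain ⟨r', h1, h2⟩ := ih (r := a :: r) (by simpa using H)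
    obtain ⟨r'', h3, h4⟩ := exists_mem_selections_of_perm h2
    refine ⟨r'', ?_, h4⟩
    rw [List.length_append, List.length_singleton]
    exact mem_multiSelections_succ.2 ⟨h, r', a, h1, h3, rfl⟩

variable [Primcodable α]

theorem primrec_selections : Primrec (selections : List α → List (α × List α)) := by
  have h := Primrec.list_rec (f := fun l : List α => l) (g := fun _ => ([] : List (α × List α)))
    (h := fun (_ : List α) (q : α × List α × List (α × List α)) =>
      (q.1, q.2.1) :: q.2.2.map fun p => (p.1, q.1 :: p.2)) Primrec.id (Primrec.const []) ?_
  · refine h.of_eq fun l => ?_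
    induction l with
    | nil => rfl
    | cons a l ih => simp only [selections, ← ih]
  · have h1 := Primrec.fst.comp (Primrec.snd (α := List α)
      (β := α × List α × List (α × List α)))
    have h2 := Primrec.snd.comp (Primrec.snd (α := List α)
      (β := α × List α × List (α × List α)))
    refine (Primrec.list_cons.comp (Primrec.pair h1 (Primrec.fst.comp h2))
      (Primrec.list_map (g := fun (q : List α × α × List α × List (α × List α)) p =>
        (p.1, q.2.1 :: p.2)) (Primrec.snd.comp h2) ?_))
    exact Primrec.pair (Primrec.fst.comp Primrec.snd) (Primrec.list_cons.comp
      (h1.comp Primrec.fst) (Primrec.snd.comp Primrec.snd))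

theorem primrec_multiSelections :
    Primrec₂ (multiSelections : ℕ → List α → List (List α × List α)) := by
  have h := Primrec.nat_rec (f := fun l : List α => [(([] : List α), l)])
    (g := fun (_ : List α) (q : ℕ × List (List α × List α)) => q.2.flatMap fun q =>
      (selections q.2).map fun p => (q.1 ++ [p.1], p.2)) ?_ ?_
  · exact h.swap
  · exact Primrec.list_cons.comp (Primrec.pair (Primrec.const []) Primrec.id) (Primrec.const [])
  · refine Primrec.list_flatMap (Primrec.snd.comp Primrec.snd) ?_
    refine Primrec.list_map (primrec_selections.comp (Primrec.snd.comp Primrec.snd)) ?_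
    exact Primrec.pair (Primrec.list_concat.comp
      (Primrec.fst.comp (Primrec.snd.comp Primrec.fst)) (Primrec.fst.comp Primrec.snd))
      (Primrec.snd.comp Primrec.snd)

end Selections

section Assignments

variable {C : Type*}

/-- All assignments of terms from `T` to the variables `xs`, as association lists. -/
def assignments (xs : List ℕ) (T : List (Term C)) : List (List (ℕ × Term C)) :=
  xs.foldr (fun x θs => θs.flatMap fun θ => T.map fun t => (x, t) :: θ) [[]]

/-- The substitution given by an association list. It fixes the variables that are not listed. -/
def toSubst (θ : List (ℕ × Term C)) (x : ℕ) : Term C := (θ.lookup x).getD (.var x)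

theorem mem_assignments {xs : List ℕ} {T : List (Term C)} {θ : List (ℕ × Term C)} :
    θ ∈ assignments xs T ↔ θ.map Prod.fst = xs ∧ ∀ p ∈ θ, p.2 ∈ T := by
  induction xs generalizing θ with
  | nil => simp +contextual [assignments]
  | cons x xs ih =>
    change θ ∈ (assignments xs T).flatMap _ ↔ _
    simp only [List.mem_flatMap, List.mem_map]
    constructor
    · rintro ⟨θ', h, t, ht, rfl⟩
      obtain ⟨h1, h2⟩ := ih.1 h
      exact ⟨congrArg (x :: ·) h1, List.forall_mem_cons.2 ⟨ht, h2⟩⟩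
    · rintro ⟨h1, h2⟩
      cases θ with
      | nil => simp at h1
      | cons p θ =>
        rw [List.map_cons] at h1
        obtain ⟨rfl, h3⟩ := List.cons.inj h1
        exact ⟨θ, ih.2 ⟨h3, fun p hp => h2 p (List.mem_cons_of_mem _ hp)⟩, p.2, h2 p (by simp), rfl⟩

theorem toSubst_mem_or {θ : List (ℕ × Term C)} (x : ℕ) :
    (x, toSubst θ x) ∈ θ ∨ x ∉ θ.map Prod.fst ∧ toSubst θ x = .var x := by
  induction θ with
  | nil => simp [toSubst]
  | cons p θ ih =>
    obtain ⟨y, t⟩ := p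
    by_cases hxy : x = y
    · subst hxy
      simp [toSubst]
    · have : toSubst ((y, t) :: θ) x = toSubst θ x := by
        have hxy' : (x == y) = false := beq_false_of_ne hxy
        simp [toSubst, List.lookup_cons, hxy']
      rw [this]
      simpa [hxy] using ih

theorem toSubst_map_mk (σ : ℕ → Term C) {xs : List ℕ} {x : ℕ} (hx : x ∈ xs) :
    toSubst (xs.map fun x => (x, σ x)) x = σ x := by
  rcases toSubst_mem_or (θ := xs.map fun x => (x, σ x)) x with h | h
  · obtain ⟨y, -, hy⟩ := List.mem_map.1 h
    obtain ⟨rfl, hy⟩ := Prod.mk.inj hy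
    exact hy.symm
  · exact absurd hx (by simpa using h.1)

variable [Primcodable C]

theorem primrec_assignments :
    Primrec₂ (assignments : List ℕ → List (Term C) → List (List (ℕ × Term C))) := by
  refine Primrec.list_foldr (h := fun (p : List ℕ × List (Term C))
    (q : ℕ × List (List (ℕ × Term C))) => q.2.flatMap fun θ => p.2.map fun t => (q.1, t) :: θ)
    Primrec.fst (Primrec.const [[]]) ?_
  refine Primrec.list_flatMap (Primrec.snd.comp Primrec.snd)
    (Primrec.list_map (Primrec.snd.comp (Primrec.fst.comp Primrec.fst)) ?_)
  exact Primrec.list_cons.comp (Primrec.pair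
    (Primrec.fst.comp (Primrec.snd.comp (Primrec.fst.comp Primrec.fst))) Primrec.snd)
    (Primrec.snd.comp Primrec.fst)

theorem primrec_toSubst : Primrec₂ (toSubst : List (ℕ × Term C) → ℕ → Term C) :=
  Primrec.option_getD.comp (Primrec.listLookup.comp Primrec.snd Primrec.fst)
    (primrec_term_var.comp Primrec.snd)

end Assignments

/-! ### Configurations without identifiers -/

section Abstraction

variable {C Q : Type*}

/-- A configuration without identifiers: the goal, the CHR constraints of the store and the
built-in store, each as a list. -/
abbrev State (C Q : Type*) := List (Constraint C Q) × List (Atom C Q) × List (Eqn C)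

namespace Rule

/-- The kept heads, then the removed ones. -/
def heads (r : Rule C Q) : List (Atom C Q) := r.kept ++ r.removed

/-- The variables of the head, possibly with repetitions. -/
def headVarList (r : Rule C Q) : List ℕ :=
  r.heads.flatMap fun a => a.args.flatMap fun t => Term.casesOn t (fun x => [x]) fun _ => []

theorem mem_headVarList {r : Rule C Q} {x : ℕ} : x ∈ r.headVarList ↔ x ∈ r.headVars := by
  simp only [headVarList, heads, headVars, Atom.vars, List.mem_flatMap, Set.mem_ofPred_eq]
  refine exists_congr fun a => and_congr_right fun _ => exists_congr fun t =>
    and_congr_right fun _ => ?_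
  cases t <;> simp [Term.vars]

end Rule

/-- The conditions under which the rule `r` can be applied to the list `H` of constraints with the
substitution `θ`, for the built-in store `B`. -/
def Matching.Fires (m : Matching) (B : List (Eqn C)) (r : Rule C Q) (θ : ℕ → Term C)
    (H : List (Atom C Q)) : Prop :=
  let heads := r.heads.map (Atom.subst θ)
  let D := equations H heads ++ r.guard.map (Eqn.subst θ)
  match m with
  | .syntactic => H = heads ∧ Satisfiable B ∧ EntailsExists B (eqnVars B) D
  | .moduloStore =>
      H.map (fun a => (a.name, a.args.length)) = heads.map (fun a => (a.name, a.args.length)) ∧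
      Satisfiable B ∧ ∀ ν, Satisfies ν B → Satisfies ν D

/-- The effect of **Solve** or **Introduce** on the selected constraint `c`. -/
def processed (c : Constraint C Q) (G : List (Constraint C Q)) (s : State C Q) : State C Q :=
  Constraint.casesOn c (fun a => (G, a :: s.2.1, s.2.2)) (fun e => (G, s.2.1, e :: s.2.2))

/-- The effect of **Apply**, where `H` are the matched constraints and `R` the remaining ones. -/
def fired (r : Rule C Q) (θ : ℕ → Term C) (H R : List (Atom C Q)) (s : State C Q) : State C Q :=
  (r.body.map (Constraint.subst θ) ++ s.1, H.take r.kept.length ++ R,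
    equations H (r.heads.map (Atom.subst θ)) ++ s.2.2)

open Classical in
/-- The successors of a state by **Solve** and **Introduce**. -/
noncomputable def processSuccessors (s : State C Q) : List (State C Q) :=
  if Satisfiable s.2.2 then (selections s.1).map fun p => processed p.1 p.2 s else []

open Classical in
/-- The successors of a state by **Apply**. -/
noncomputable def applySuccessors (m : Matching) (P : Program C Q) (s : State C Q) :
    List (State C Q) :=
  P.flatMap fun r => (multiSelections r.heads.length s.2.1).flatMap fun p =>
    (assignments r.headVarList (p.1.flatMap Atom.args)).flatMap fun θ =>
      if m.Fires s.2.2 r (toSubst θ) p.1 then [fired r (toSubst θ) p.1 p.2 s] else []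

/-- The successors of a state. A failed state has none. -/
noncomputable def successors (m : Matching) (P : Program C Q) (s : State C Q) :
    List (State C Q) :=
  processSuccessors s ++ applySuccessors m P s

theorem mem_processSuccessors {s s' : State C Q} :
    s' ∈ processSuccessors s ↔
      Satisfiable s.2.2 ∧ ∃ c G, (c, G) ∈ selections s.1 ∧ s' = processed c G s := by
  unfold processSuccessors
  split_ifs with h <;> simp [h, eq_comm]

theorem mem_applySuccessors {m : Matching} {P : Program C Q} {s s' : State C Q} :
    s' ∈ applySuccessors m P s ↔
      ∃ r ∈ P, ∃ H R, (H, R) ∈ multiSelections r.heads.length s.2.1 ∧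
        ∃ θ ∈ assignments r.headVarList (H.flatMap Atom.args),
          m.Fires s.2.2 r (toSubst θ) H ∧ s' = fired r (toSubst θ) H R s := by
  simp only [applySuccessors, List.mem_flatMap, Prod.exists]
  refine exists_congr fun r => and_congr_right fun _ => exists_congr fun H => exists_congr fun R =>
    and_congr_right fun _ => exists_congr fun θ => and_congr_right fun _ => ?_
  split_ifs with h <;> simp [h]

end Abstraction

/-! ### The successors are primitive recursive -/

section PrimrecSuccessors

variable {C Q : Type*} [Primcodable C] [Primcodable Q]

theorem primrec_subst_term :
    Primrec₂ fun (θ : List (ℕ × Term C)) (t : Term C) => t.subst (toSubst θ) := by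
  refine (primrec_term_casesOn (t := fun p : List (ℕ × Term C) × Term C => p.2)
    (f := fun p x => toSubst p.1 x) (g := fun _ a => Term.const a) Primrec.snd
    (primrec_toSubst.comp (Primrec.fst.comp Primrec.fst) Primrec.snd)
    (primrec_term_const.comp Primrec.snd)).of_eq fun p => ?_
  rcases p with ⟨_, _ | _⟩ <;> rfl

theorem primrec_subst_eqn :
    Primrec₂ fun (θ : List (ℕ × Term C)) (e : Eqn C) => e.subst (toSubst θ) :=
  primrec_eqn_mk.comp
    (primrec_subst_term.comp Primrec.fst (primrec_eqn_lhs.comp Primrec.snd))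
    (primrec_subst_term.comp Primrec.fst (primrec_eqn_rhs.comp Primrec.snd))

theorem primrec_subst_atom :
    Primrec₂ fun (θ : List (ℕ × Term C)) (a : Atom C Q) => a.subst (toSubst θ) :=
  primrec_atom_mk.comp (primrec_atom_name.comp Primrec.snd)
    (Primrec.list_map (primrec_atom_args.comp Primrec.snd)
      (primrec_subst_term.comp (Primrec.fst.comp Primrec.fst) Primrec.snd).to₂)

theorem primrec_subst_constraint :
    Primrec₂ fun (θ : List (ℕ × Term C)) (c : Constraint C Q) => c.subst (toSubst θ) := by
  refine (primrec_constraint_casesOn (c := fun p : List (ℕ × Term C) × Constraint C Q => p.2)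
    (f := fun p a => Constraint.user (a.subst (toSubst p.1)))
    (g := fun p e => Constraint.builtin (e.subst (toSubst p.1))) Primrec.snd
    (primrec_constraint_user.comp
      (primrec_subst_atom.comp (Primrec.fst.comp Primrec.fst) Primrec.snd))
    (primrec_constraint_builtin.comp
      (primrec_subst_eqn.comp (Primrec.fst.comp Primrec.fst) Primrec.snd))).of_eq fun p => ?_
  rcases p with ⟨_, _ | _⟩ <;> rfl

theorem primrec_equations :
    Primrec₂ (equations : List (Atom C Q) → List (Atom C Q) → List (Eqn C)) := by
  refine Primrec.list_flatten.comp ((primrec_zipWith ?_).comp Primrec.fst Primrec.snd)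
  exact (primrec_zipWith primrec_eqn_mk).comp (primrec_atom_args.comp Primrec.fst)
    (primrec_atom_args.comp Primrec.snd)

theorem primrec_rule_heads : Primrec (Rule.heads : Rule C Q → List (Atom C Q)) :=
  Primrec.list_append.comp primrec_rule_kept primrec_rule_removed

theorem primrec_rule_headVarList : Primrec (Rule.headVarList : Rule C Q → List ℕ) := by
  refine Primrec.list_flatMap primrec_rule_heads
    (Primrec.list_flatMap (primrec_atom_args.comp Primrec.snd) ?_)
  exact primrec_term_casesOn Primrec.snd
    (Primrec.list_cons.comp Primrec.snd (Primrec.const [])) (Primrec.const [])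

theorem primrec_heads_subst :
    Primrec₂ fun (r : Rule C Q) (θ : List (ℕ × Term C)) =>
      r.heads.map (Atom.subst (toSubst θ)) :=
  Primrec.list_map (primrec_rule_heads.comp Primrec.fst)
    (primrec_subst_atom.comp (Primrec.snd.comp Primrec.fst) Primrec.snd).to₂

/-- The data on which the firing of a rule depends. -/
abbrev FiringData (C Q : Type*) :=
  State C Q × Rule C Q × (List (Atom C Q) × List (Atom C Q)) × List (ℕ × Term C)

theorem primrec_fired :
    Primrec fun p : FiringData C Q =>
      fired p.2.1 (toSubst p.2.2.2) p.2.2.1.1 p.2.2.1.2 p.1 := by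
  have hs := Primrec.fst (α := State C Q)
    (β := Rule C Q × (List (Atom C Q) × List (Atom C Q)) × List (ℕ × Term C))
  have hr : Primrec fun p : FiringData C Q => p.2.1 := Primrec.fst.comp Primrec.snd
  have hHR : Primrec fun p : FiringData C Q => p.2.2.1 :=
    Primrec.fst.comp (Primrec.snd.comp Primrec.snd)
  have hθ : Primrec fun p : FiringData C Q => p.2.2.2 :=
    Primrec.snd.comp (Primrec.snd.comp Primrec.snd)
  refine Primrec.pair (Primrec.list_append.comp (Primrec.list_map (primrec_rule_body.comp hr)
    (primrec_subst_constraint.comp (hθ.comp Primrec.fst) Primrec.snd)) (Primrec.fst.comp hs))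
    (Primrec.pair ?_ ?_)
  · exact Primrec.list_append.comp (Primrec.list_take.comp
      (Primrec.list_length.comp (primrec_rule_kept.comp hr)) (Primrec.fst.comp hHR))
      (Primrec.snd.comp hHR)
  · exact Primrec.list_append.comp
      (primrec_equations.comp (Primrec.fst.comp hHR) (primrec_heads_subst.comp hr hθ))
      (Primrec.snd.comp (Primrec.snd.comp hs))

theorem primrec_processed :
    Primrec fun p : State C Q × Constraint C Q × List (Constraint C Q) =>
      processed p.2.1 p.2.2 p.1 := by
  have hs := (Primrec.fst (α := State C Q) (β := Constraint C Q × List (Constraint C Q)))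
  have hG := Primrec.snd.comp
    (Primrec.snd (α := State C Q) (β := Constraint C Q × List (Constraint C Q)))
  have hA := Primrec.fst.comp (Primrec.snd.comp hs)
  have hB := Primrec.snd.comp (Primrec.snd.comp hs)
  refine primrec_constraint_casesOn (Primrec.fst.comp Primrec.snd) ?_ ?_
  · exact Primrec.pair (hG.comp Primrec.fst) (Primrec.pair
      (Primrec.list_cons.comp Primrec.snd (hA.comp Primrec.fst)) (hB.comp Primrec.fst))
  · exact Primrec.pair (hG.comp Primrec.fst) (Primrec.pair (hA.comp Primrec.fst)
      (Primrec.list_cons.comp Primrec.snd (hB.comp Primrec.fst)))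

variable [Nonempty C] [DecidableEq C]

theorem primrecPred_fires (m : Matching) :
    PrimrecPred fun p : FiringData C Q =>
      m.Fires p.1.2.2 p.2.1 (toSubst p.2.2.2) p.2.2.1.1 := by
  have hB : Primrec fun p : FiringData C Q => p.1.2.2 :=
    Primrec.snd.comp (Primrec.snd.comp Primrec.fst)
  have hr : Primrec fun p : FiringData C Q => p.2.1 := Primrec.fst.comp Primrec.snd
  have hH : Primrec fun p : FiringData C Q => p.2.2.1.1 :=
    Primrec.fst.comp (Primrec.fst.comp (Primrec.snd.comp Primrec.snd))
  have hθ : Primrec fun p : FiringData C Q => p.2.2.2 :=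
    Primrec.snd.comp (Primrec.snd.comp Primrec.snd)
  have hheads := primrec_heads_subst.comp hr hθ
  have hD : Primrec fun p : FiringData C Q =>
      equations p.2.2.1.1 (p.2.1.heads.map (Atom.subst (toSubst p.2.2.2))) ++
        p.2.1.guard.map (Eqn.subst (toSubst p.2.2.2)) :=
    Primrec.list_append.comp (primrec_equations.comp hH hheads)
      (Primrec.list_map (primrec_rule_guard.comp hr)
        (primrec_subst_eqn.comp (hθ.comp Primrec.fst) Primrec.snd).to₂)
  have hshape : Primrec fun l : List (Atom C Q) => l.map fun a => (a.name, a.args.length) :=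
    Primrec.list_map Primrec.id (Primrec.pair (primrec_atom_name.comp Primrec.snd)
      (Primrec.list_length.comp (primrec_atom_args.comp Primrec.snd))).to₂
  cases m with
  | syntactic => exact (Primrec.eq.comp hH hheads).and (primrecRel_entailsExists.comp hB hD)
  | moduloStore =>
    exact (Primrec.eq.comp (hshape.comp hH) (hshape.comp hheads)).and
      (primrecRel_entails.comp hB hD)

theorem primrec_successors (m : Matching) :
    Primrec₂ (successors m : Program C Q → State C Q → List (State C Q)) := by
  classical
  have h1 : Primrec (processSuccessors : State C Q → List (State C Q)) := by
    refine Primrec.ite (primrecPred_satisfiable.comp (Primrec.snd.comp Primrec.snd))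
      (Primrec.list_map (primrec_selections.comp Primrec.fst) ?_) (Primrec.const [])
    exact primrec_processed
  have h2 : Primrec₂ (applySuccessors m : Program C Q → State C Q → List (State C Q)) := by
    refine Primrec.list_flatMap Primrec.fst ?_
    refine Primrec.list_flatMap (primrec_multiSelections.comp
      (Primrec.list_length.comp (primrec_rule_heads.comp Primrec.snd))
      (Primrec.fst.comp (Primrec.snd.comp (Primrec.snd.comp Primrec.fst)))) ?_
    refine Primrec.list_flatMap (primrec_assignments.comp
      (primrec_rule_headVarList.comp (Primrec.snd.comp Primrec.fst))
      (Primrec.list_flatMap (Primrec.fst.comp Primrec.snd)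
        (primrec_atom_args.comp Primrec.snd).to₂)) ?_
    have hdata : Primrec fun q : (((Program C Q × State C Q) × Rule C Q) ×
        (List (Atom C Q) × List (Atom C Q))) × List (ℕ × Term C) =>
        ((q.1.1.1.2, q.1.1.2, q.1.2, q.2) : FiringData C Q) :=
      Primrec.pair (Primrec.snd.comp (Primrec.fst.comp (Primrec.fst.comp Primrec.fst)))
        (Primrec.pair (Primrec.snd.comp (Primrec.fst.comp Primrec.fst))
          (Primrec.pair (Primrec.snd.comp Primrec.fst) Primrec.snd))
    exact Primrec.ite ((primrecPred_fires m).comp hdata)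
      (Primrec.list_cons.comp (primrec_fired.comp hdata) (Primrec.const [])) (Primrec.const [])
  exact Primrec.list_append.comp (h1.comp Primrec.snd) h2

end PrimrecSuccessors

/-! ### Monotonicity -/

section Monotone

variable {C Q : Type*}

/-- Inclusion of multisets presented by lists. -/
def Included {α : Type*} (l l' : List α) : Prop := ∃ r, l'.Perm (l ++ r)

theorem Included.refl {α : Type*} (l : List α) : Included l l := ⟨[], by simp⟩

theorem Included.trans {α : Type*} {l l' l'' : List α} (h : Included l l')
    (h' : Included l' l'') : Included l l'' := by
  obtain ⟨r, h⟩ := h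
  obtain ⟨r', h'⟩ := h'
  exact ⟨r ++ r', h'.trans (by simpa using h.append_right r')⟩

theorem Included.append_left {α : Type*} {l l' : List α} (h : Included l l') (k : List α) :
    Included (k ++ l) (k ++ l') := by
  obtain ⟨r, h⟩ := h
  exact ⟨r, by simpa using h.append_left k⟩

theorem included_of_sublist {α : Type*} {l l' : List α} (h : l.Sublist l') : Included l l' :=
  h.exists_perm_append

theorem exists_selections_of_included {α : Type*} {l l' r : List α} {a : α} (h : Included l l')
    (hr : (a, r) ∈ selections l) : ∃ r', (a, r') ∈ selections l' ∧ Included r r' := by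
  obtain ⟨k, hk⟩ := h
  obtain ⟨r', h1, h2⟩ := exists_mem_selections_of_perm (a := a) (r := r ++ k)
    (hk.trans (by simpa using (perm_of_mem_selections hr).append_right k))
  exact ⟨r', h1, k, h2⟩

theorem exists_multiSelections_of_included {α : Type*} {n : ℕ} {l l' h r : List α}
    (hl : Included l l') (hr : (h, r) ∈ multiSelections n l) :
    ∃ r', (h, r') ∈ multiSelections n l' ∧ Included r r' := by
  obtain ⟨k, hk⟩ := hl
  obtain ⟨rfl, hp⟩ := perm_of_mem_multiSelections hr
  obtain ⟨r', h1, h2⟩ := exists_mem_multiSelections_of_perm (h := h) (r := r ++ k)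
    (hk.trans (by simpa using hp.append_right k))
  exact ⟨r', h1, k, h2⟩

theorem included_iff_multiSelections {α : Type*} {l l' : List α} :
    Included l l' ↔ ∃ p ∈ multiSelections l.length l', p.1 = l := by
  constructor
  · rintro ⟨r, h⟩
    obtain ⟨r', h, -⟩ := exists_mem_multiSelections_of_perm h
    exact ⟨_, h, rfl⟩
  · rintro ⟨⟨_, r⟩, h, rfl⟩
    exact ⟨r, (perm_of_mem_multiSelections h).2⟩

theorem primrecRel_included {α : Type*} [Primcodable α] :
    PrimrecRel (Included : List α → List α → Prop) :=
  (primrecPred_exists_mem (p := fun (p : List α × List α) (q : List α × List α) => q.1 = p.1)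
    (primrec_multiSelections.comp (Primrec.list_length.comp Primrec.fst) Primrec.snd)
    (Primrec.eq.comp (Primrec.fst.comp Primrec.snd) (Primrec.fst.comp Primrec.fst))).of_eq
    fun _ => included_iff_multiSelections.symm

/-- The order on states: inclusion of goals and of CHR stores, and the same equations in the
built-in stores. Over a finite vocabulary it is a well-quasi-order. -/
def State.le (s t : State C Q) : Prop :=
  Included s.1 t.1 ∧ Included s.2.1 t.2.1 ∧ ∀ e, e ∈ s.2.2 ↔ e ∈ t.2.2

theorem State.le_refl (s : State C Q) : State.le s s :=
  ⟨.refl _, .refl _, fun _ => Iff.rfl⟩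

theorem State.le_trans (s t u : State C Q) (h : State.le s t) (h' : State.le t u) :
    State.le s u :=
  ⟨h.1.trans h'.1, h.2.1.trans h'.2.1, fun e => (h.2.2 e).trans (h'.2.2 e)⟩

theorem primrecRel_state_le [Primcodable C] [Primcodable Q] :
    PrimrecRel (State.le : State C Q → State C Q → Prop) := by
  have hB := Primrec.snd.comp (Primrec.snd (α := List (Constraint C Q))
    (β := List (Atom C Q) × List (Eqn C)))
  have hS := Primrec.fst.comp (Primrec.snd (α := List (Constraint C Q))
    (β := List (Atom C Q) × List (Eqn C)))
  refine (primrecRel_included.comp (Primrec.fst.comp Primrec.fst)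
    (Primrec.fst.comp Primrec.snd)).and
    ((primrecRel_included.comp (hS.comp Primrec.fst) (hS.comp Primrec.snd)).and ?_)
  refine ((primrecPred_forall_mem (p := fun (p : State C Q × State C Q) e => e ∈ p.2.2.2)
    (hB.comp Primrec.fst) (primrecRel_mem.comp Primrec.snd
      (hB.comp (Primrec.snd.comp Primrec.fst)))).and
    (primrecPred_forall_mem (p := fun (p : State C Q × State C Q) e => e ∈ p.1.2.2)
    (hB.comp Primrec.snd) (primrecRel_mem.comp Primrec.snd
      (hB.comp (Primrec.fst.comp Primrec.fst))))).of_eq fun p => ?_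
  exact ⟨fun h e => ⟨h.1 e, h.2 e⟩, fun h => ⟨fun e => (h e).1, fun e => (h e).2⟩⟩

theorem satisfies_congr {B B' : List (Eqn C)} (h : ∀ e, e ∈ B ↔ e ∈ B') (ν : ℕ → C) :
    Satisfies ν B ↔ Satisfies ν B' := by
  simp only [Satisfies, h]

theorem satisfiable_congr {B B' : List (Eqn C)} (h : ∀ e, e ∈ B ↔ e ∈ B') :
    Satisfiable B ↔ Satisfiable B' := exists_congr (satisfies_congr h)

/-- Firing depends on the equations in the built-in store only. -/
theorem Matching.fires_congr {m : Matching} {B B' : List (Eqn C)} (h : ∀ e, e ∈ B ↔ e ∈ B')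
    {r : Rule C Q} {θ : ℕ → Term C} {H : List (Atom C Q)} :
    m.Fires B r θ H ↔ m.Fires B' r θ H := by
  have hv : eqnVars B = eqnVars B' := by simp only [eqnVars, h]
  cases m <;> simp only [Matching.Fires, satisfiable_congr h, EntailsExists, satisfies_congr h, hv]

theorem exists_successors_of_le {m : Matching} {P : Program C Q} {s t s' : State C Q}
    (hst : State.le s t) (hs' : s' ∈ successors m P s) :
    ∃ t' ∈ successors m P t, State.le s' t' := by
  obtain ⟨hG, hS, hB⟩ := hst
  rcases List.mem_append.1 hs' with h | h
  · obtain ⟨hsat, c, G, hc, rfl⟩ := mem_processSuccessors.1 h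
    obtain ⟨G', hc', hGG'⟩ := exists_selections_of_included hG hc
    refine ⟨_, List.mem_append_left _ (mem_processSuccessors.2
      ⟨(satisfiable_congr hB).1 hsat, c, G', hc', rfl⟩), ?_⟩
    cases c with
    | user a => exact ⟨hGG', hS.append_left [a], hB⟩
    | builtin e => exact ⟨hGG', hS, fun e' => by simp [processed, hB]⟩
  · obtain ⟨r, hr, H, R, hHR, θ, hθ, hf, rfl⟩ := mem_applySuccessors.1 h
    obtain ⟨R', hHR', hRR'⟩ := exists_multiSelections_of_included hS hHR
    refine ⟨_, List.mem_append_right _ (mem_applySuccessors.2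
      ⟨r, hr, H, R', hHR', θ, hθ, (Matching.fires_congr hB).1 hf, rfl⟩), ?_⟩
    exact ⟨hG.append_left _, hRR'.append_left _, fun e => by simp [fired, hB]⟩

end Monotone

/-! ### The well-quasi-order on the states of a computation -/

section WellQuasiOrder

variable {C Q : Type*}

/-- The arguments of a CHR constraint, or the two sides of an equation. -/
def Constraint.terms : Constraint C Q → List (Term C)
  | .user a => a.args
  | .builtin e => [e.lhs, e.rhs]

/-- The predicate symbol of a CHR constraint: its name and its arity. -/
def Constraint.symbols : Constraint C Q → List (Q × ℕ)
  | .user a => [(a.name, a.args.length)]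
  | .builtin _ => []

/-- The constraint is built from the terms `U` and the predicate symbols `N`. -/
def Constraint.Over (U : List (Term C)) (N : List (Q × ℕ)) (c : Constraint C Q) : Prop :=
  c.terms ⊆ U ∧ c.symbols ⊆ N

/-- The state is built from the terms `U` and the predicate symbols `N`. -/
def State.Over (U : List (Term C)) (N : List (Q × ℕ)) (s : State C Q) : Prop :=
  (∀ c ∈ s.1, c.Over U N) ∧ (∀ a ∈ s.2.1, (Constraint.user a).Over U N) ∧
    ∀ e ∈ s.2.2, (Constraint.builtin e : Constraint C Q).Over U N

theorem finite_lists_over {α : Type*} (U : List α) (n : ℕ) :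
    {l : List α | l.length = n ∧ l ⊆ U}.Finite := by
  have : Finite {x // x ∈ U} := (List.finite_toSet U).to_subtype
  refine ((List.finite_length_eq {x // x ∈ U} n).image (List.map Subtype.val)).subset ?_
  rintro l ⟨rfl, hU⟩
  exact ⟨l.attachWith (· ∈ U) fun x hx => hU hx, by simp, by simp⟩

theorem finite_constraints_over (U : List (Term C)) (N : List (Q × ℕ)) :
    {c : Constraint C Q | c.Over U N}.Finite := by
  have h1 : (⋃ p ∈ {p | p ∈ N}, (fun l => Constraint.user (⟨p.1, l⟩ : Atom C Q)) ''
      {l : List (Term C) | l.length = p.2 ∧ l ⊆ U}).Finite :=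
    (List.finite_toSet N).biUnion fun p _ => (finite_lists_over U p.2).image _
  have h2 : ((fun p : Term C × Term C => (Constraint.builtin ⟨p.1, p.2⟩ : Constraint C Q)) ''
      ({t | t ∈ U} ×ˢ {t | t ∈ U})).Finite :=
    ((List.finite_toSet U).prod (List.finite_toSet U)).image _
  refine (h1.union h2).subset ?_
  rintro (⟨n, l⟩ | ⟨t, u⟩) ⟨hU, hN⟩
  · refine Or.inl (Set.mem_biUnion (x := (n, l.length)) (hN (by simp [Constraint.symbols])) ?_)
    exact ⟨l, ⟨rfl, hU⟩, rfl⟩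
  · exact Or.inr ⟨(t, u), ⟨hU (by simp [Constraint.terms]), hU (by simp [Constraint.terms])⟩, rfl⟩

theorem partiallyWellOrderedOn_included {α : Type*} {A : Set α} (hA : A.Finite) :
    {l : List α | ∀ x ∈ l, x ∈ A}.PartiallyWellOrderedOn Included := by
  have h := Set.PartiallyWellOrderedOn.partiallyWellOrderedOn_sublistForall₂ (Eq : α → α → Prop)
    (hA.partiallyWellOrderedOn (r := Eq))
  refine Set.partiallyWellOrderedOn_iff_exists_lt.2 fun f hf => ?_
  obtain ⟨m, n, hmn, hle⟩ := h.exists_lt hf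
  obtain ⟨l, h1, h2⟩ := List.sublistForall₂_iff.1 hle
  rw [List.forall₂_eq_eq_eq] at h1
  exact ⟨m, n, hmn, included_of_sublist (h1 ▸ h2)⟩

theorem partiallyWellOrderedOn_same_members {α : Type*} {A : Set α} (hA : A.Finite) :
    {l : List α | ∀ x ∈ l, x ∈ A}.PartiallyWellOrderedOn
      fun l l' => ∀ x, x ∈ l ↔ x ∈ l' := by
  refine Set.partiallyWellOrderedOn_iff_exists_lt.2 fun f hf => ?_
  obtain ⟨m, n, hmn, h⟩ := hA.finite_subsets.exists_lt_map_eq_of_forall_mem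
    (f := fun n => {x | x ∈ f n}) fun n => show {x | x ∈ f n} ⊆ A from hf n
  exact ⟨m, n, hmn, fun x => Set.ext_iff.1 h x⟩

/-- Dickson's lemma for states over a finite vocabulary. -/
theorem exists_lt_state_le {U : List (Term C)} {N : List (Q × ℕ)} {f : ℕ → State C Q}
    (hf : ∀ n, (f n).Over U N) : ∃ m n, m < n ∧ State.le (f m) (f n) := by
  have hfin := finite_constraints_over U N
  have hA : {a : Atom C Q | (Constraint.user a).Over U N}.Finite :=
    hfin.preimage fun _ _ _ _ h => Constraint.user.inj h
  have hE : {e : Eqn C | (Constraint.builtin e : Constraint C Q).Over U N}.Finite :=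
    hfin.preimage fun _ _ _ _ h => Constraint.builtin.inj h
  have : IsPreorder (List (Atom C Q)) Included :=
    { refl := .refl, trans := fun _ _ _ => .trans }
  have : IsPreorder (List (Constraint C Q)) Included :=
    { refl := .refl, trans := fun _ _ _ => .trans }
  exact ((partiallyWellOrderedOn_included hfin).prod
    ((partiallyWellOrderedOn_included hA).prod
      (partiallyWellOrderedOn_same_members hE))).exists_lt
      fun n => ⟨(hf n).1, (hf n).2.1, (hf n).2.2⟩

theorem exists_of_mem_zipWith {α β γ : Type*} {f : α → β → γ} {l : List α} {l' : List β} {c : γ}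
    (h : c ∈ List.zipWith f l l') : ∃ a ∈ l, ∃ b ∈ l', f a b = c := by
  rw [← List.map_uncurry_zip_eq_zipWith] at h
  obtain ⟨⟨a, b⟩, hab, rfl⟩ := List.mem_map.1 h
  exact ⟨a, (List.of_mem_zip hab).1, b, (List.of_mem_zip hab).2, rfl⟩

theorem mem_equations {l l' : List (Atom C Q)} {e : Eqn C} (he : e ∈ equations l l') :
    ∃ a ∈ l, ∃ b ∈ l', e.lhs ∈ a.args ∧ e.rhs ∈ b.args := by
  obtain ⟨E, hE, he⟩ := List.mem_flatten.1 he
  obtain ⟨a, ha, b, hb, rfl⟩ := exists_of_mem_zipWith hE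
  obtain ⟨t, ht, u, hu, rfl⟩ := exists_of_mem_zipWith he
  exact ⟨a, ha, b, hb, ht, hu⟩

theorem subst_mem_of_mem {U : List (Term C)} {θ : ℕ → Term C}
    (hθ : ∀ x, θ x ∈ U ∨ θ x = .var x) {t : Term C} (ht : t ∈ U) : t.subst θ ∈ U := by
  cases t with
  | var x => exact (hθ x).elim id fun h => by simpa [Term.subst, h] using ht
  | const a => exact ht

theorem Constraint.Over.subst {U : List (Term C)} {N : List (Q × ℕ)} {θ : ℕ → Term C}
    (hθ : ∀ x, θ x ∈ U ∨ θ x = .var x) {c : Constraint C Q} (hc : c.Over U N) :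
    (c.subst θ).Over U N := by
  have h {t} (ht : t ∈ c.terms) : t.subst θ ∈ U := subst_mem_of_mem hθ (hc.1 ht)
  cases c with
  | user a =>
    refine ⟨fun t ht => ?_, by simpa [Constraint.subst, symbols, Atom.subst] using hc.2⟩
    obtain ⟨u, hu, rfl⟩ := List.mem_map.1 ht
    exact h hu
  | builtin e =>
    refine ⟨?_, by simp [Constraint.subst, symbols]⟩
    simp only [Constraint.subst, terms, List.cons_subset, List.nil_subset, and_true]
    exact ⟨h (by simp [terms]), h (by simp [terms])⟩

/-- The rule is built from the terms `U` and, in its body, from the predicate symbols `N`. -/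
def Rule.Over (U : List (Term C)) (N : List (Q × ℕ)) (r : Rule C Q) : Prop :=
  (∀ a ∈ r.heads, a.args ⊆ U) ∧ ∀ c ∈ r.body, c.Over U N

/-- Transitions do not leave a vocabulary that contains the program. -/
theorem State.Over.successors {U : List (Term C)} {N : List (Q × ℕ)} {m : Matching}
    {P : Program C Q} (hP : ∀ r ∈ P, r.Over U N) {s s' : State C Q} (hs : s.Over U N)
    (hs' : s' ∈ successors m P s) : s'.Over U N := by
  obtain ⟨hG, hS, hB⟩ := hs
  rcases List.mem_append.1 hs' with h | h
  · obtain ⟨-, c, G, hc, rfl⟩ := mem_processSuccessors.1 h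
    have hperm := perm_of_mem_selections hc
    have hc' : c.Over U N := hG c (hperm.mem_iff.2 (by simp))
    have hG' : ∀ c ∈ G, c.Over U N := fun d hd => hG d (hperm.mem_iff.2 (by simp [hd]))
    cases c with
    | user a => exact ⟨hG', List.forall_mem_cons.2 ⟨hc', hS⟩, hB⟩
    | builtin e => exact ⟨hG', hS, List.forall_mem_cons.2 ⟨hc', hB⟩⟩
  · obtain ⟨r, hr, H, R, hHR, θ, hθ, -, rfl⟩ := mem_applySuccessors.1 h
    obtain ⟨hhead, hbody⟩ := hP r hr
    have hperm := (perm_of_mem_multiSelections hHR).2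
    have hH : ∀ a ∈ H, (Constraint.user a).Over U N :=
      fun a ha => hS a (hperm.mem_iff.2 (by simp [ha]))
    have hR : ∀ a ∈ R, (Constraint.user a).Over U N :=
      fun a ha => hS a (hperm.mem_iff.2 (by simp [ha]))
    have hθU (x : ℕ) : toSubst θ x ∈ U ∨ toSubst θ x = .var x := by
      refine (toSubst_mem_or x).imp (fun h => ?_) And.right
      obtain ⟨a, ha, hxa⟩ := List.mem_flatMap.1 ((mem_assignments.1 hθ).2 _ h)
      exact (hH a ha).1 hxa
    refine ⟨?_, ?_, ?_⟩
    · refine List.forall_mem_append.2 ⟨?_, hG⟩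
      simpa using fun c hc => (hbody c hc).subst hθU
    · exact List.forall_mem_append.2 ⟨fun a ha => hH a (List.mem_of_mem_take ha), hR⟩
    · refine List.forall_mem_append.2 ⟨fun e he => ⟨?_, by simp [Constraint.symbols]⟩, hB⟩
      obtain ⟨a, ha, b, hb, hl, hr⟩ := mem_equations he
      obtain ⟨b', hb', rfl⟩ := List.mem_map.1 hb
      obtain ⟨t, ht, htr⟩ := List.mem_map.1 hr
      simp only [Constraint.terms, List.cons_subset, List.nil_subset, and_true, ← htr]
      exact ⟨(hH a ha).1 hl, subst_mem_of_mem hθU (hhead b' hb' ht)⟩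

theorem exists_lt_state_le_of_run {m : Matching} {P : Program C Q} {G : Goal C Q}
    {f : ℕ → State C Q} (hf0 : f 0 = (G, [], []))
    (hf : ∀ n, f (n + 1) ∈ successors m P (f n)) : ∃ m n, m < n ∧ State.le (f m) (f n) := by
  let U : List (Term C) := G.flatMap Constraint.terms ++
    P.flatMap fun r => r.heads.flatMap Atom.args ++ r.body.flatMap Constraint.terms
  let N : List (Q × ℕ) := G.flatMap Constraint.symbols ++
    P.flatMap fun r => r.body.flatMap Constraint.symbols
  have hP : ∀ r ∈ P, r.Over U N := by
    refine fun r hr => ⟨fun a ha t ht => ?_, fun c hc => ⟨fun t ht => ?_, fun p hp => ?_⟩⟩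
    · exact List.mem_append_right _ (List.mem_flatMap.2 ⟨r, hr,
        List.mem_append_left _ (List.mem_flatMap.2 ⟨a, ha, ht⟩)⟩)
    · exact List.mem_append_right _ (List.mem_flatMap.2 ⟨r, hr,
        List.mem_append_right _ (List.mem_flatMap.2 ⟨c, hc, ht⟩)⟩)
    · exact List.mem_append_right _ (List.mem_flatMap.2 ⟨r, hr, List.mem_flatMap.2 ⟨c, hc, hp⟩⟩)
  refine exists_lt_state_le (U := U) (N := N) fun n => ?_
  induction n with
  | zero =>
    rw [hf0]
    refine ⟨fun c hc => ⟨fun t ht => ?_, fun p hp => ?_⟩, by simp, by simp⟩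
    · exact List.mem_append_left _ (List.mem_flatMap.2 ⟨c, hc, ht⟩)
    · exact List.mem_append_left _ (List.mem_flatMap.2 ⟨c, hc, hp⟩)
  | succ n ih => exact ih.successors hP (hf n)

end WellQuasiOrder

/-! ### Configurations and states simulate each other -/

section Simulation

variable {C Q : Type*}

theorem Term.subst_congr {θ θ' : ℕ → Term C} {t : Term C} (h : ∀ x ∈ t.vars, θ x = θ' x) :
    t.subst θ = t.subst θ' := by
  cases t with
  | var x => exact h x rfl
  | const a => rfl

theorem Eqn.subst_congr {θ θ' : ℕ → Term C} {e : Eqn C} (h : ∀ x ∈ e.vars, θ x = θ' x) :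
    e.subst θ = e.subst θ' :=
  congrArg₂ Eqn.mk (Term.subst_congr fun x hx => h x (.inl hx))
    (Term.subst_congr fun x hx => h x (.inr hx))

theorem Atom.subst_congr {θ θ' : ℕ → Term C} {a : Atom C Q} (h : ∀ x ∈ a.vars, θ x = θ' x) :
    a.subst θ = a.subst θ' :=
  congrArg (Atom.mk a.name) (List.map_congr_left fun t ht =>
    Term.subst_congr fun x hx => h x ⟨t, ht, hx⟩)

theorem Constraint.subst_congr {θ θ' : ℕ → Term C} {c : Constraint C Q}
    (h : ∀ x ∈ c.vars, θ x = θ' x) : c.subst θ = c.subst θ' := by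
  cases c with
  | user a => exact congrArg _ (Atom.subst_congr h)
  | builtin e => exact congrArg _ (Eqn.subst_congr h)

theorem Term.eval_congr {ν ν' : ℕ → C} {t : Term C} (h : ∀ x ∈ t.vars, ν x = ν' x) :
    t.eval ν = t.eval ν' := by
  cases t with
  | var x => exact h x rfl
  | const a => rfl

/-- For a range-restricted rule the applicability condition has no part about fresh variables, and
under matching modulo the store no variable of the conclusion is quantified existentially. -/
theorem applicable_iff {m : Matching} {s : Config C Q} {r : Rule C Q} (hr : r.RangeRestricted)
    {θ : ℕ → Term C} {H₁ H₂ : List (Atom C Q)} (hH : ∀ a ∈ H₁ ++ H₂, a.vars ⊆ s.vars)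
    (hsat : Satisfiable s.builtins) :
    m.Applicable s r θ H₁ H₂ ↔ H₁.length = r.kept.length ∧ H₂.length = r.removed.length ∧
      (∀ x ∈ r.headVars, ∃ a ∈ H₁ ++ H₂, θ x ∈ a.args) ∧
      m.Fires s.builtins r θ (H₁ ++ H₂) := by
  have hfresh : (r.bodyVars ∪ r.guardVars) \ r.headVars = ∅ := Set.sdiff_eq_empty.2 hr
  simp only [Matching.Applicable, hfresh]
  refine and_congr_right fun _ => and_congr_right fun _ => and_congr_right fun hθ => ?_
  rw [and_iff_right ⟨id, by simp, by simp⟩]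
  cases m with
  | syntactic => simp [Matching.Fires, Rule.heads, hsat]
  | moduloStore =>
    simp only [Matching.Fires, ← List.forall₂_eq_eq_eq, List.forall₂_map_left_iff,
      List.forall₂_map_right_iff, Prod.mk.injEq, hsat, true_and, Rule.heads]
    refine and_congr_right fun _ => ⟨fun h ν hν => ?_, fun h ν hν => ⟨ν, by simp, h ν hν⟩⟩
    obtain ⟨ν', hν', hD⟩ := h ν hν
    have known {t : Term C} (ht : ∃ a ∈ H₁ ++ H₂, t ∈ a.args) : t.eval ν = t.eval ν' := by
      obtain ⟨a, ha, hta⟩ := ht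
      exact Term.eval_congr fun x hx => (hν' x (hH a ha ⟨t, hta, hx⟩)).symm
    have subst_known {t : Term C} (ht : t.vars ⊆ r.headVars) :
        (t.subst θ).eval ν = (t.subst θ).eval ν' := by
      cases t with
      | var x => exact known (hθ x (ht rfl))
      | const a => rfl
    intro e he
    have hl : e.lhs.eval ν = e.lhs.eval ν' ∧ e.rhs.eval ν = e.rhs.eval ν' := by
      rcases List.mem_append.1 he with he | he
      · obtain ⟨a, ha, b, hb, hla, hrb⟩ := mem_equations he
        obtain ⟨b', hb', rfl⟩ := List.mem_map.1 hb
        obtain ⟨t, ht, htr⟩ := List.mem_map.1 hrb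
        refine ⟨known ⟨a, ha, hla⟩, htr ▸ subst_known fun x hx => ?_⟩
        exact ⟨b', hb', t, ht, hx⟩
      · obtain ⟨d, hd, rfl⟩ := List.mem_map.1 he
        exact ⟨subst_known fun x hx => hr (.inr ⟨d, hd, .inl hx⟩),
          subst_known fun x hx => hr (.inr ⟨d, hd, .inr hx⟩)⟩
    rw [hl.1, hl.2, hD e he]

theorem atom_vars_subset_config_vars {s : Config C Q} {H : List (Atom C Q × ℕ)}
    (hH : ∀ p ∈ H, p ∈ s.store) : ∀ a ∈ H.map Prod.fst, a.vars ⊆ s.vars := by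
  intro a ha x hx
  obtain ⟨p, hp, rfl⟩ := List.mem_map.1 ha
  exact Or.inl (Or.inr ⟨p, hH p hp, hx⟩)

/-- The state `a` lists the components of the configuration `s`, whose identifiers are smaller
than the next free one. -/
def Represents (s : Config C Q) (a : State C Q) : Prop :=
  s.goal = ↑a.1 ∧ s.store.val.map Prod.fst = ↑a.2.1 ∧ s.builtins = a.2.2 ∧
    ∀ p ∈ s.store, p.2 < s.next

theorem represents_initial (G : Goal C Q) : Represents (initial G) (G, [], []) :=
  ⟨rfl, rfl, rfl, by simp [initial]⟩

variable [DecidableEq C] [DecidableEq Q]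

theorem val_toFinset_union {α : Type*} [DecidableEq α] {H : List α} {S : Finset α}
    (hH : H.Nodup) (hS : ∀ p ∈ H, p ∉ S) : (H.toFinset ∪ S).val = ↑H + S.val := by
  have hd : Disjoint H.toFinset S :=
    Finset.disjoint_left.2 fun p hp => hS p (List.mem_toFinset.1 hp)
  rw [← Finset.disjUnion_eq_union _ _ hd, Finset.disjUnion_val, List.toFinset_val, hH.dedup]

theorem exists_map_eq_of_multiset_map_eq {α β : Type*} [DecidableEq α] {f : α → β} (l : List β)
    {s : Multiset α} (h : s.map f = ↑l) : ∃ l' : List α, s = ↑l' ∧ l'.map f = l := by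
  induction l generalizing s with
  | nil => exact ⟨[], by simpa using h, rfl⟩
  | cons b l ih =>
    obtain ⟨a, ha, rfl, hs⟩ := (Multiset.map_eq_cons f s ↑l b).2 h
    obtain ⟨l', hl', rfl⟩ := ih hs
    exact ⟨a :: l', by rw [← Multiset.cons_coe, ← hl', Multiset.cons_erase ha], rfl⟩

/-- The configuration after **Apply** is represented by the state after firing. -/
theorem represents_fired {a : State C Q} {r : Rule C Q} {θ θ' : ℕ → Term C}
    (hr : r.RangeRestricted) (hθ : ∀ x ∈ r.headVars, θ x = θ' x)
    {H₁ H₂ : List (Atom C Q × ℕ)} {G : Multiset (Constraint C Q)} {S : Finset (Atom C Q × ℕ)}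
    {n : ℕ} {R : List (Atom C Q)} (hG : G = ↑a.1) (hnodup : (H₁ ++ H₂).Nodup)
    (hdisj : ∀ p ∈ H₁ ++ H₂, p ∉ S) (hR : S.val.map Prod.fst = ↑R)
    (hlt : ∀ p ∈ (H₁ ++ H₂).toFinset ∪ S, p.2 < n) (hlen : H₁.length = r.kept.length) :
    Represents ⟨((r.body.map (Constraint.subst θ) : List (Constraint C Q)) : Multiset _) + G,
      H₁.toFinset ∪ S, equations ((H₁ ++ H₂).map Prod.fst)
        ((r.kept ++ r.removed).map (Atom.subst θ)) ++ a.2.2, n⟩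
      (fired r θ' ((H₁ ++ H₂).map Prod.fst) R a) := by
  have hbody : r.body.map (Constraint.subst θ) = r.body.map (Constraint.subst θ') :=
    List.map_congr_left fun c hc => Constraint.subst_congr fun x hx =>
      hθ x (hr (.inl ⟨c, hc, hx⟩))
  have hheads : (r.kept ++ r.removed).map (Atom.subst θ) = r.heads.map (Atom.subst θ') :=
    List.map_congr_left fun b hb => Atom.subst_congr fun x hx => hθ x ⟨b, hb, hx⟩
  refine ⟨?_, ?_, ?_, ?_⟩
  · rw [hbody, hG]
    rfl
  · have htake : ((H₁ ++ H₂).map Prod.fst).take r.kept.length = H₁.map Prod.fst := by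
      rw [← hlen, List.map_append, List.take_left' (by simp)]
    rw [val_toFinset_union (List.nodup_append.1 hnodup).1
      fun p hp => hdisj p (List.mem_append_left _ hp), Multiset.map_add, hR]
    simp only [fired, htake]
    rfl
  · rw [hheads]
    rfl
  · intro p hp
    refine hlt p ?_
    simp only [Finset.mem_union, List.mem_toFinset, List.mem_append] at hp ⊢
    tauto

/-- Each transition of a non-failed configuration is matched by its states. -/
theorem Represents.exists_successor {m : Matching} {P : Program C Q} (hP : P.RangeRestricted)
    {s s' : Config C Q} {a : State C Q} (ha : Represents s a) (hs : ¬ s.Failed)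
    (hstep : Step m P s s') : ∃ a' ∈ successors m P a, Represents s' a' := by
  obtain ⟨hG, hS, hB, hlt⟩ := ha
  have hsat : Satisfiable s.builtins := not_not.1 hs
  cases hstep with
  | solve e G S B n =>
    dsimp only at hG hS hB hlt hsat
    obtain ⟨r, hr, hperm⟩ := exists_mem_selections_of_perm (l := a.1) (a := .builtin e)
      (r := G.toList) (Multiset.coe_eq_coe.1 (by rw [← hG, ← Multiset.cons_coe, G.coe_toList]))
    refine ⟨_, List.mem_append_left _ (mem_processSuccessors.2 ⟨hB ▸ hsat, _, r, hr, rfl⟩), ?_⟩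
    refine ⟨?_, hS, congrArg _ hB, hlt⟩
    exact G.coe_toList.symm.trans (Multiset.coe_eq_coe.2 hperm.symm)
  | introduce b G S B n =>
    dsimp only at hG hS hB hlt hsat
    obtain ⟨r, hr, hperm⟩ := exists_mem_selections_of_perm (l := a.1) (a := .user b)
      (r := G.toList) (Multiset.coe_eq_coe.1 (by rw [← hG, ← Multiset.cons_coe, G.coe_toList]))
    refine ⟨_, List.mem_append_left _ (mem_processSuccessors.2 ⟨hB ▸ hsat, _, r, hr, rfl⟩), ?_⟩
    have hnew : (b, n) ∉ S := fun h => lt_irrefl n (hlt _ h)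
    refine ⟨?_, ?_, hB, ?_⟩
    · exact G.coe_toList.symm.trans (Multiset.coe_eq_coe.2 hperm.symm)
    · dsimp only
      rw [Finset.insert_val_of_notMem hnew, Multiset.map_cons, hS]
      rfl
    · intro p hp
      rcases Finset.mem_insert.1 hp with rfl | hp
      · exact Nat.lt_succ_self n
      · exact (hlt p hp).trans (Nat.lt_succ_self n)
  | apply r hr θ H₁ H₂ G S B n hnodup hdisj happ =>
    dsimp only at hG hS hB hlt hsat
    obtain ⟨hl₁, hl₂, hθ, hf⟩ := (applicable_iff (hP r hr) (by
      rw [← List.map_append]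
      exact atom_vars_subset_config_vars fun p hp =>
        Finset.mem_union_left _ (List.mem_toFinset.2 hp)) hsat).1 happ
    rw [← List.map_append] at hθ hf
    rw [val_toFinset_union hnodup hdisj, Multiset.map_add] at hS
    obtain ⟨R, hR, hperm⟩ := exists_mem_multiSelections_of_perm (l := a.2.1)
      (h := (H₁ ++ H₂).map Prod.fst) (r := (S.val.map Prod.fst).toList)
      (Multiset.coe_eq_coe.1 (by
        rw [← hS, ← Multiset.coe_add ((H₁ ++ H₂).map Prod.fst), Multiset.coe_toList]
        rfl))
    have hlen : ((H₁ ++ H₂).map Prod.fst).length = r.heads.length := by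
      simpa [Rule.heads] using congrArg₂ (· + ·) hl₁ hl₂
    -- Only the values on head variables matter, and these can be tabulated.
    let θ' := r.headVarList.map fun x => (x, θ x)
    have hθ' : ∀ x ∈ r.headVars, θ x = toSubst θ' x := fun x hx =>
      (toSubst_map_mk θ (Rule.mem_headVarList.2 hx)).symm
    refine ⟨_, List.mem_append_right _ (mem_applySuccessors.2
      ⟨r, hr, _, R, hlen ▸ hR, θ', mem_assignments.2 ⟨?_, ?_⟩, ?_, rfl⟩), ?_⟩
    · simp [θ', Function.comp_def]
    · rintro p hp
      obtain ⟨x, hx, rfl⟩ := List.mem_map.1 hp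
      exact List.mem_flatMap.2 (hθ x (Rule.mem_headVarList.1 hx))
    · have hheads : r.heads.map (Atom.subst θ) = r.heads.map (Atom.subst (toSubst θ')) :=
        List.map_congr_left fun b hb => Atom.subst_congr fun x hx => hθ' x ⟨b, hb, hx⟩
      have hguard : r.guard.map (Eqn.subst θ) = r.guard.map (Eqn.subst (toSubst θ')) :=
        List.map_congr_left fun e he => Eqn.subst_congr fun x hx =>
          hθ' x (hP r hr (.inr ⟨e, he, hx⟩))
      rw [← hB]
      cases m <;> simpa only [Matching.Fires, hheads, hguard] using hf
    · subst hB
      exact represents_fired (hP r hr) hθ' hG hnodup hdisj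
        ((Multiset.coe_toList _).symm.trans (Multiset.coe_eq_coe.2 hperm.symm)) hlt
        (by simpa using hl₁)

/-- Each transition of a state lifts to the configurations that it represents. -/
theorem Represents.exists_step {m : Matching} {P : Program C Q} (hP : P.RangeRestricted)
    {s : Config C Q} {a a' : State C Q} (ha : Represents s a) (ha' : a' ∈ successors m P a) :
    ¬ s.Failed ∧ ∃ s', Step m P s s' ∧ Represents s' a' := by
  obtain ⟨G, S, B, n⟩ := s
  obtain ⟨hG, hS, hB, hlt⟩ := ha
  dsimp only at hG hS hB hlt
  subst hB
  rcases List.mem_append.1 ha' with h | h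
  · obtain ⟨hsat, c, G', hc, rfl⟩ := mem_processSuccessors.1 h
    refine ⟨not_not.2 hsat, ?_⟩
    obtain rfl : G = c ::ₘ ↑G' :=
      hG.trans (Multiset.coe_eq_coe.2 (perm_of_mem_selections hc))
    cases c with
    | user b =>
      have hnew : (b, n) ∉ S := fun h => lt_irrefl n (hlt _ h)
      refine ⟨_, Step.introduce _ _ _ _ _, rfl, ?_, rfl, ?_⟩
      · dsimp only
        rw [Finset.insert_val_of_notMem hnew, Multiset.map_cons, hS]
        rfl
      · intro p hp
        rcases Finset.mem_insert.1 hp with rfl | hp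
        · exact Nat.lt_succ_self n
        · exact (hlt p hp).trans (Nat.lt_succ_self n)
    | builtin e => exact ⟨_, Step.solve _ _ _ _ _, rfl, hS, rfl, hlt⟩
  · obtain ⟨r, hr, H, R, hHR, θ, hθ, hf, rfl⟩ := mem_applySuccessors.1 h
    have hsat : Satisfiable a.2.2 := by cases m <;> exact hf.2.1
    refine ⟨not_not.2 hsat, ?_⟩
    obtain ⟨hlen, hperm⟩ := perm_of_mem_multiSelections hHR
    obtain ⟨K, hK, hKmap⟩ := exists_map_eq_of_multiset_map_eq (H ++ R)
      (hS.trans (Multiset.coe_eq_coe.2 hperm))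
    obtain ⟨Hp, Rp, rfl, rfl, rfl⟩ := List.map_eq_append_iff.1 hKmap
    have hnodup : (Hp ++ Rp).Nodup := Multiset.coe_nodup.1 (hK ▸ S.nodup)
    obtain ⟨hHp, hRp, hdisj⟩ := List.nodup_append'.1 hnodup
    have hdisj' : ∀ p ∈ Hp, p ∉ Rp.toFinset := fun p hp hp' =>
      hdisj hp (List.mem_toFinset.1 hp')
    obtain rfl : S = Hp.toFinset ∪ Rp.toFinset := Finset.val_injective (by
      rw [val_toFinset_union hHp hdisj', List.toFinset_val, hRp.dedup, hK]
      rfl)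
    obtain ⟨H₁, H₂, rfl, hl₁⟩ : ∃ H₁ H₂, Hp = H₁ ++ H₂ ∧ H₁.length = r.kept.length := by
      refine ⟨Hp.take r.kept.length, Hp.drop r.kept.length, (List.take_append_drop _ _).symm, ?_⟩
      simp only [List.length_map, Rule.heads, List.length_append] at hlen
      simp [hlen]
    have hl₂ : H₂.length = r.removed.length := by
      simp only [List.length_map, Rule.heads, List.length_append] at hlen
      omega
    have hθ' : ∀ x ∈ r.headVars, ∃ b ∈ (H₁ ++ H₂).map Prod.fst, toSubst θ x ∈ b.args := by
      intro x hx
      obtain ⟨h1, h2⟩ := mem_assignments.1 hθ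
      rcases toSubst_mem_or (θ := θ) x with h | h
      · exact List.mem_flatMap.1 (h2 _ h)
      · exact absurd (h1 ▸ Rule.mem_headVarList.2 hx) h.1
    refine ⟨_, Step.apply r hr (toSubst θ) H₁ H₂ G Rp.toFinset a.2.2 n hHp hdisj' ?_, ?_⟩
    · refine (applicable_iff (hP r hr) ?_ hsat).2
        ⟨by simpa using hl₁, by simpa using hl₂, ?_, ?_⟩
      · rw [← List.map_append]
        exact atom_vars_subset_config_vars fun p hp =>
          Finset.mem_union_left _ (List.mem_toFinset.2 hp)
      · rwa [← List.map_append]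
      · rwa [← List.map_append]
    · exact represents_fired (hP r hr) (fun _ _ => rfl) hG hHp hdisj'
        (by rw [List.toFinset_val, hRp.dedup]; rfl) hlt hl₁

theorem hasInfiniteComputation_iff_hasRun {m : Matching} {P : Program C Q}
    (hP : P.RangeRestricted) (G : Goal C Q) :
    HasInfiniteComputation m P G ↔ HasRun (successors m P) (G, [], []) := by
  constructor
  · rintro ⟨s, hs0, hs⟩
    refine hasRun_of_forall_exists (p := fun a => ∃ i, Represents (s i) a) ?_
      ⟨0, hs0 ▸ represents_initial G⟩
    rintro a ⟨i, hi⟩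
    obtain ⟨a', ha', hr⟩ := hi.exists_successor hP (fun h => (hs i).1 (.inl h)) (hs i).2
    exact ⟨a', ha', i + 1, hr⟩
  · rintro ⟨f, hf0, hf⟩
    have hstep (n : ℕ) (s : {s : Config C Q // Represents s (f n)}) :=
      s.2.exists_step hP (hf n)
    choose hfail next hnext hrep using hstep
    let g (n : ℕ) : {s : Config C Q // Represents s (f n)} :=
      Nat.rec ⟨initial G, hf0 ▸ represents_initial G⟩ (fun n s => ⟨next n s, hrep n s⟩) n
    refine ⟨fun n => (g n).1, rfl, fun n => ⟨?_, hnext n (g n)⟩⟩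
    rintro (h | ⟨-, h⟩)
    · exact hfail n (g n) h
    · exact h _ (hnext n (g n))

end Simulation

end CHR

theorem mainTheorem1 {C Q : Type*} [Nonempty C] [DecidableEq C] [DecidableEq Q]
    [Primcodable C] [Primcodable Q] (m : CHR.Matching) :
    ∃ decideInf : CHR.Program C Q × CHR.Goal C Q → Bool, Computable decideInf ∧
      ∀ (P : CHR.Program C Q) (G : CHR.Goal C Q),
        P.WellFormed → P.RangeRestricted →
          (decideInf (P, G) = true ↔ CHR.HasInfiniteComputation m P G) := by
  obtain ⟨d, hd, hspec⟩ := CHR.exists_computable_hasRun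
    (start := fun i : CHR.Program C Q × CHR.Goal C Q => ((i.2, [], []) : CHR.State C Q))
    (next := fun i => CHR.successors m i.1)
    (Primrec.pair Primrec.snd (Primrec.const _))
    ((CHR.primrec_successors m).comp (Primrec.fst.comp Primrec.fst) Primrec.snd)
    CHR.primrecRel_state_le CHR.State.le_refl CHR.State.le_trans
    (fun _ _ _ _ => CHR.exists_successors_of_le)
    (fun _ _ => CHR.exists_lt_state_le_of_run)
  exact ⟨d, hd, fun P G _ hP =>
    (hspec (P, G)).trans (CHR.hasInfiniteComputation_iff_hasRun hP G).symm⟩
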